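/- Let $N\ge 1$, let $\Omega\subseteq\mathbb R^N$ be a bounded domain with $C^2$-boundary, let $1<p<\infty$, and put $p^*=\frac{Np}{N-p}$ if $p<N$, $p^*=+\infty$ if $p\ge N$. Let $W^{1,p}_0(\Omega)$ be the closure of $C_c^\infty(\Omega)$ in the Sobolev norm $(\|u\|_{L^p}^p+\|\nabla u\|_{L^p}^p)^{1/p}$ (equivalent there to $\|\nabla u\|_{L^p}$ by Poincaré's inequality), and let $\hat\lambda_1(p)$ be the smallest eigenvalue of the Dirichlet $p$-Laplacian on $\Omega$, i.e. the smallest $\lambda$ for which $-\Delta_pu=\lambda|u|^{p-2}u$ has a nontrivial weak solution in $W^{1,p}_0(\Omega)$. Let $\vartheta\in C^1(0,\infty)$ and constants $\hat c,c_0,c_1,c_2>0$ be such that, for all $t>0$, $$\hat c\le \frac{t\vartheta'(t)}{\vartheta(t)}\le c_0,\qquad c_1t^{p-1}\le\vartheta(t)\le c_2(1+t^{p-1}).$$ Hypotheses $H(a)_1$: $a(\xi)=a_0(\|\xi\|)\xi$ for $\xi\in\mathbb R^N$, with $a_0(t)>0$ for all $t>0$, and with $G_0(t)=\int_0^t s\,a_0(s)\,ds$,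 (i) $a_0\in C^1(0,\infty)$, $t\mapsto ta_0(t)$ is strictly increasing on $(0,\infty)$, $\lim_{t\to0^+}ta_0(t)=0$, and $\lim_{t\to0^+}\frac{ta_0'(t)}{a_0(t)}$ exists and is $>-1$; (ii) $\|\nabla a(\xi)\|\le c_3\frac{\vartheta(\|\xi\|)}{\|\xi\|}$ for all $\xi\ne0$ and some $c_3>0$; (iii) $(\nabla a(\xi)y,y)\ge\frac{\vartheta(\|\xi\|)}{\|\xi\|}\|y\|^2$ for all $\xi\neq0$ and all $y\in\mathbb R^N$; (iv) $pG_0(t)-t^2a_0(t)\ge-c_6$ and $t^2a_0(t)-G_0(t)\ge\hat\eta t^p$ for all $t>0$ and some $c_6,\hat\eta>0$. Hypotheses $H(f)_1$: $f:\Omega\times\mathbb R\to\mathbb R$ is a Carathéodory function (measurable in $x$ for every $s$, continuous in $s$ for a.a. $x$) with $f(x,0)=0$ for a.a. $x\in\Omega$, and with $F(x,s)=\int_0^sf(x,t)\,dt$, (i) $|f(x,s)|\le\alpha(x)(1+|s|^{r-1})$ for a.a. $x\in\Omega$ and all $s\in\mathbb R$, with $0\le\alpha\in L^\infty(\Omega)$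 and $p<r<p^*$; (ii) $\lim_{s\to\pm\infty}\frac{F(x,s)}{|s|^p}=+\infty$ uniformly for a.a. $x\in\Omega$; (iii) there are $\tau\in\left((r-p)\max\{\frac Np,1\},p^*\right)$ and $\beta_0>0$ with $\liminf_{s\to\pm\infty}\frac{f(x,s)s-pF(x,s)}{|s|^\tau}\ge\beta_0$ uniformly for a.a. $x\in\Omega$; (iv) there is $0\le\eta\in L^\infty(\Omega)$ with $\eta\le\frac{c_1}{p-1}\hat\lambda_1(p)$ a.e. in $\Omega$, $\eta$ not a.e. equal to $\frac{c_1}{p-1}\hat\lambda_1(p)$, and $\limsup_{s\to0}\frac{pF(x,s)}{|s|^p}\le\eta(x)$ uniformly for a.a. $x\in\Omega$; (v) for every $\varrho>0$ there is $\kappa_\varrho>0$ with $f(x,s)s+\kappa_\varrho|s|^p\ge0$ for a.a. $x\in\Omega$ and all $|s|\le\varrho$. Let $G(\xi)=G_0(\|\xi\|)$, $s^\pm=\max\{\pm s,0\}$, $f_\pm(x,s)=f(x,\pm s^\pm)$, $F_\pm(x,s)=\int_0^sf_\pm(x,t)\,dt$, and for $u\in W^{1,p}_0(\Omega)$ $$\varphi(u)=\int_\Omega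 G(\nabla u)\,dx-\int_\Omega F(x,u)\,dx,\qquad \varphi_\pm(u)=\int_\Omega G(\nabla u)\,dx-\int_\Omega F_\pm(x,u)\,dx .$$ If $H(a)_1$ and $H(f)_1$ hold, then each $\phi\in\{\varphi,\varphi_+,\varphi_-\}$ is of class $C^1$ on $X=W^{1,p}_0(\Omega)$ and satisfies the Cerami condition: every sequence $(u_n)\subseteq X$ such that $(\phi(u_n))$ is bounded in $\mathbb R$ and $(1+\|u_n\|_X)\phi'(u_n)\to0$ in $X^*$ has a subsequence converging strongly in $X$. -/

import Mathlib

open MeasureTheory Filter Topology Set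
open scoped ENNReal ContDiff

noncomputable section

/-- `ℝ^N` with the Euclidean norm. -/
abbrev RN (N : ℕ) : Type := EuclideanSpace ℝ (Fin N)

instance fact_one_le_ofReal (p : ℝ) [hp : Fact (1 < p)] : Fact (1 ≤ ENNReal.ofReal p) :=
  ⟨ENNReal.one_le_ofReal.2 hp.out.le⟩

/-- A bounded domain of `ℝ^N` with `C²` boundary: near each boundary point, `Ω` is the sublevel set
`{ρ < 0}` of a `C²` function `ρ` without critical points. -/
structure IsBoundedC2Domain {N : ℕ} (Ω : Set (RN N)) : Prop where
  isOpen : IsOpen Ω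
  isConnected : IsConnected Ω
  isBounded : Bornology.IsBounded Ω
  boundary : ∀ x₀ ∈ frontier Ω, ∃ U : Set (RN N), IsOpen U ∧ x₀ ∈ U ∧
    ∃ ρ : RN N → ℝ, ContDiffOn ℝ 2 ρ U ∧ (∀ x ∈ U, fderiv ℝ ρ x ≠ 0) ∧
      ∀ x ∈ U, x ∈ Ω ↔ ρ x < 0

/-! ### The Sobolev space `W^{1,p}_0(Ω)` -/

/-- `C_c^∞(Ω)`. -/
structure IsTestFunction {N : ℕ} (Ω : Set (RN N)) (ψ : RN N → ℝ) : Prop where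
  contDiff : ContDiff ℝ ∞ ψ
  hasCompactSupport : HasCompactSupport ψ
  tsupport_subset : tsupport ψ ⊆ Ω

/-- The space `L^p(Ω) × L^p(Ω; ℝ^N)` with the norm `(‖u‖_p ^ p + ‖g‖_p ^ p) ^ (1 / p)`. -/
abbrev LpPair {N : ℕ} (Ω : Set (RN N)) (p : ℝ) : Type :=
  WithLp (ENNReal.ofReal p)
    (Lp ℝ (ENNReal.ofReal p) (volume.restrict Ω) × Lp (RN N) (ENNReal.ofReal p) (volume.restrict Ω))

/-- The pairs `(ψ, ∇ψ)` with `ψ ∈ C_c^∞(Ω)`, as a subspace of `L^p(Ω) × L^p(Ω; ℝ^N)`. -/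
def testPairs {N : ℕ} (Ω : Set (RN N)) (p : ℝ) [Fact (1 < p)] : Submodule ℝ (LpPair Ω p) where
  carrier := {w | ∃ ψ : RN N → ℝ, IsTestFunction Ω ψ ∧
    w.fst =ᵐ[volume.restrict Ω] ψ ∧ w.snd =ᵐ[volume.restrict Ω] gradient ψ}
  zero_mem' := by
    refine ⟨fun _ => 0, ⟨contDiff_const, HasCompactSupport.zero, ?_⟩, ?_, ?_⟩
    · simp [tsupport]
    · exact Lp.coeFn_zero _ _ _
    · have h : gradient (fun _ : RN N => (0 : ℝ)) = 0 := by
        funext x; simp [gradient]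
      rw [h]
      exact Lp.coeFn_zero _ _ _
  add_mem' := by
    rintro w₁ w₂ ⟨ψ₁, h₁, a₁, b₁⟩ ⟨ψ₂, h₂, a₂, b₂⟩
    refine ⟨ψ₁ + ψ₂, ⟨h₁.contDiff.add h₂.contDiff,
      h₁.hasCompactSupport.add h₂.hasCompactSupport,
      (tsupport_add ψ₁ ψ₂).trans (union_subset h₁.tsupport_subset h₂.tsupport_subset)⟩, ?_, ?_⟩
    · rw [WithLp.add_fst]
      filter_upwards [Lp.coeFn_add w₁.fst w₂.fst, a₁, a₂] with x hx h1 h2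
      rw [hx, Pi.add_apply, Pi.add_apply, h1, h2]
    · rw [WithLp.add_snd]
      filter_upwards [Lp.coeFn_add w₁.snd w₂.snd, b₁, b₂] with x hx h1 h2
      rw [hx, Pi.add_apply, h1, h2, gradient, gradient, gradient,
        fderiv_add (h₁.contDiff.differentiable (by simp) x)
          (h₂.contDiff.differentiable (by simp) x), map_add]
  smul_mem' := by
    rintro c w ⟨ψ, h, a, b⟩
    refine ⟨c • ψ, ⟨h.contDiff.const_smul c, h.hasCompactSupport.smul_left (f := fun _ => c),
      (tsupport_smul_subset_right (fun _ => c) ψ).trans h.tsupport_subset⟩, ?_, ?_⟩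
    · rw [WithLp.smul_fst]
      filter_upwards [Lp.coeFn_smul c w.fst, a] with x hx h1
      rw [hx, Pi.smul_apply, Pi.smul_apply, h1]
    · rw [WithLp.smul_snd]
      filter_upwards [Lp.coeFn_smul c w.snd, b] with x hx h1
      rw [hx, Pi.smul_apply, h1, gradient, gradient,
        fderiv_const_smul (h.contDiff.differentiable (by simp) x)]
      simp

/-- `W^{1,p}_0(Ω)`: the closure of `C_c^∞(Ω)` for the Sobolev norm
`(‖u‖_p ^ p + ‖∇u‖_p ^ p) ^ (1 / p)`. An element is stored as the pair `(u, ∇u)` of the function and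
its weak gradient (the weak gradient is determined by the function). -/
abbrev W1p0 {N : ℕ} (Ω : Set (RN N)) (p : ℝ) [Fact (1 < p)] : Type :=
  (testPairs Ω p).topologicalClosure

/-- The function underlying an element of `W^{1,p}_0(Ω)`. -/
def W1p0.fn {N : ℕ} {Ω : Set (RN N)} {p : ℝ} [Fact (1 < p)] (u : W1p0 Ω p) : RN N → ℝ :=
  (u : LpPair Ω p).fst

/-- The weak gradient of an element of `W^{1,p}_0(Ω)`. -/
def W1p0.grad {N : ℕ} {Ω : Set (RN N)} {p : ℝ} [Fact (1 < p)] (u : W1p0 Ω p) : RN N → RN N :=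
  (u : LpPair Ω p).snd

/-- The critical Sobolev exponent `p^*`. -/
def critExp (N : ℕ) (p : ℝ) : EReal :=
  if p < N then ((N * p / (N - p) : ℝ) : EReal) else ⊤

/-- `lam` is an eigenvalue of the Dirichlet `p`-Laplacian: `-Δ_p u = lam |u|^{p-2} u` has a nontrivial
weak solution in `W^{1,p}_0(Ω)`. -/
def IsPLaplaceEigenvalue {N : ℕ} (Ω : Set (RN N)) (p : ℝ) [Fact (1 < p)] (lam : ℝ) : Prop :=
  ∃ u : W1p0 Ω p, u ≠ 0 ∧ ∀ v : W1p0 Ω p,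
    ∫ x in Ω, ‖u.grad x‖ ^ (p - 2) * inner ℝ (u.grad x) (v.grad x)
      = lam * ∫ x in Ω, |u.fn x| ^ (p - 2) * u.fn x * v.fn x

/-- The first (smallest) eigenvalue of the Dirichlet `p`-Laplacian. -/
def firstEigenvalue {N : ℕ} (Ω : Set (RN N)) (p : ℝ) [Fact (1 < p)] : ℝ :=
  sInf {lam | IsPLaplaceEigenvalue Ω p lam}

/-! ### Hypotheses on the differential operator -/

/-- The comparison function `ϑ ∈ C¹(0, ∞)`. -/
structure IsComparison (p : ℝ) (ϑ : ℝ → ℝ) (chat c₀ c₁ c₂ : ℝ) : Prop where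
  chat_pos : 0 < chat
  c₀_pos : 0 < c₀
  c₁_pos : 0 < c₁
  c₂_pos : 0 < c₂
  contDiffOn : ContDiffOn ℝ 1 ϑ (Ioi 0)
  log_deriv : ∀ t > 0, chat ≤ t * deriv ϑ t / ϑ t ∧ t * deriv ϑ t / ϑ t ≤ c₀
  growth : ∀ t > 0, c₁ * t ^ (p - 1) ≤ ϑ t ∧ ϑ t ≤ c₂ * (1 + t ^ (p - 1))

/-- `a(ξ) = a₀(‖ξ‖) ξ`. -/
def aMap (N : ℕ) (a₀ : ℝ → ℝ) (ξ : RN N) : RN N := a₀ ‖ξ‖ • ξ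

/-- `G₀(t) = ∫₀ᵗ s a₀(s) ds`. -/
def G₀ (a₀ : ℝ → ℝ) (t : ℝ) : ℝ := ∫ s in (0 : ℝ)..t, s * a₀ s

/-- `G(ξ) = G₀(‖ξ‖)`. -/
def GFun (N : ℕ) (a₀ : ℝ → ℝ) (ξ : RN N) : ℝ := G₀ a₀ ‖ξ‖

/-- The hypotheses on `a(ξ) = a₀(‖ξ‖) ξ`. -/
structure HypA (N : ℕ) (p : ℝ) (ϑ a₀ : ℝ → ℝ) : Prop where
  pos : ∀ t > 0, 0 < a₀ t
  contDiffOn : ContDiffOn ℝ 1 a₀ (Ioi 0)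
  strictMono : StrictMonoOn (fun t => t * a₀ t) (Ioi 0)
  tendsto_zero : Tendsto (fun t => t * a₀ t) (𝓝[>] 0) (𝓝 0)
  log_deriv : ∃ L > -1, Tendsto (fun t => t * deriv a₀ t / a₀ t) (𝓝[>] 0) (𝓝 L)
  upper : ∃ c₃ > 0, ∀ ξ : RN N, ξ ≠ 0 → ‖fderiv ℝ (aMap N a₀) ξ‖ ≤ c₃ * (ϑ ‖ξ‖ / ‖ξ‖)
  lower : ∀ ξ : RN N, ξ ≠ 0 → ∀ y : RN N,
    ϑ ‖ξ‖ / ‖ξ‖ * ‖y‖ ^ 2 ≤ inner ℝ (fderiv ℝ (aMap N a₀) ξ y) y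
  primitive_lower : ∃ c₆ > 0, ∀ t > 0, -c₆ ≤ p * G₀ a₀ t - t ^ 2 * a₀ t
  primitive_upper : ∃ η > 0, ∀ t > 0, η * t ^ p ≤ t ^ 2 * a₀ t - G₀ a₀ t

/-! ### Hypotheses on the reaction -/

/-- `F(x, s) = ∫₀ˢ f(x, t) dt`. -/
def primitiveF {N : ℕ} (f : RN N → ℝ → ℝ) (x : RN N) (s : ℝ) : ℝ := ∫ t in (0 : ℝ)..s, f x t

/-- Carathéodory functions on `Ω × ℝ`. -/
structure IsCaratheodory {N : ℕ} (Ω : Set (RN N)) (f : RN N → ℝ → ℝ) : Prop where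
  measurable : ∀ s, AEMeasurable (fun x => f x s) (volume.restrict Ω)
  continuous : ∀ᵐ x ∂volume.restrict Ω, Continuous (f x)

/-- The cone `L^∞(Ω)_+`. -/
def IsLinftyPos {N : ℕ} (Ω : Set (RN N)) (h : RN N → ℝ) : Prop :=
  MemLp h ⊤ (volume.restrict Ω) ∧ ∀ᵐ x ∂volume.restrict Ω, 0 ≤ h x

/-- The hypotheses on the reaction `f`; `c₁` is the constant in the lower bound of `ϑ`. -/
structure HypF {N : ℕ} (Ω : Set (RN N)) (p : ℝ) [Fact (1 < p)] (c₁ : ℝ) (r : ℝ)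
    (f : RN N → ℝ → ℝ) : Prop where
  caratheodory : IsCaratheodory Ω f
  zero : ∀ᵐ x ∂volume.restrict Ω, f x 0 = 0
  p_lt_r : p < r
  r_lt_crit : (r : EReal) < critExp N p
  growth : ∃ α : RN N → ℝ, IsLinftyPos Ω α ∧
    ∀ᵐ x ∂volume.restrict Ω, ∀ s : ℝ, |f x s| ≤ α x * (1 + |s| ^ (r - 1))
  superlinear : ∀ K : ℝ, ∃ S > 0, ∀ᵐ x ∂volume.restrict Ω, ∀ s : ℝ, S ≤ |s| →
    K ≤ primitiveF f x s / |s| ^ p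
  quasi_superlinear : ∃ τ : ℝ, (r - p) * max (N / p) 1 < τ ∧ (τ : EReal) < critExp N p ∧
    ∃ β₀ > 0, ∀ ε > 0, ∃ S > 0, ∀ᵐ x ∂volume.restrict Ω, ∀ s : ℝ, S ≤ |s| →
      β₀ - ε ≤ (f x s * s - p * primitiveF f x s) / |s| ^ τ
  near_zero : ∃ η : RN N → ℝ, IsLinftyPos Ω η ∧
    (∀ᵐ x ∂volume.restrict Ω, η x ≤ c₁ / (p - 1) * firstEigenvalue Ω p) ∧
    (¬ ∀ᵐ x ∂volume.restrict Ω, η x = c₁ / (p - 1) * firstEigenvalue Ω p) ∧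
    ∀ ε > 0, ∃ δ > 0, ∀ᵐ x ∂volume.restrict Ω, ∀ s : ℝ, 0 < |s| → |s| < δ →
      p * primitiveF f x s / |s| ^ p ≤ η x + ε
  sign : ∀ ϱ > 0, ∃ κ > 0, ∀ᵐ x ∂volume.restrict Ω, ∀ s : ℝ, |s| ≤ ϱ →
    0 ≤ f x s * s + κ * |s| ^ p

/-! ### The energy functionals and the Cerami condition -/

/-- `φ(u) = ∫_Ω G(∇u) dx - ∫_Ω F(x, u) dx`. -/
def energy {N : ℕ} (Ω : Set (RN N)) (p : ℝ) [Fact (1 < p)] (a₀ : ℝ → ℝ) (f : RN N → ℝ → ℝ)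
    (u : W1p0 Ω p) : ℝ :=
  (∫ x in Ω, GFun N a₀ (u.grad x)) - ∫ x in Ω, primitiveF f x (u.fn x)

/-- `f₊(x, s) = f(x, s⁺)`. -/
def truncPos {N : ℕ} (f : RN N → ℝ → ℝ) (x : RN N) (s : ℝ) : ℝ := f x (max s 0)

/-- `f₋(x, s) = f(x, -s⁻)`. -/
def truncNeg {N : ℕ} (f : RN N → ℝ → ℝ) (x : RN N) (s : ℝ) : ℝ := f x (-max (-s) 0)

/-- `φ ∈ C¹(X)` and `φ` satisfies the Cerami condition. -/
def CeramiCondition {X : Type*} [NormedAddCommGroup X] [NormedSpace ℝ X] (φ : X → ℝ) : Prop :=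
  ContDiff ℝ 1 φ ∧
    ∀ u : ℕ → X, (∃ M : ℝ, ∀ n, |φ (u n)| ≤ M) →
      Tendsto (fun n => (1 + ‖u n‖) • fderiv ℝ φ (u n)) atTop (𝓝 0) →
      ∃ (u₀ : X) (k : ℕ → ℕ), StrictMono k ∧ Tendsto (u ∘ k) atTop (𝓝 u₀)

end

/-!
The derivative of the energy is the pairing with `a (∇u)` minus the pairing with `f (x, u)`, each of
them a continuous superposition operator between Lebesgue spaces. Along a Cerami sequence the
quasi-superlinearity of `f` bounds `∫ |u|^τ`. Interpolating the exponent `r` between `τ` and a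
Sobolev exponent turns this into `∫ |u|^r ≤ C * ‖∇u‖^σ` with `σ < p`, and testing the derivative
with `u` itself bounds the gradients. By the compactness of the Sobolev embedding a subsequence
converges in `L^r`, so the functionals obtained by pairing with `a (∇u_n)` converge in the dual
space, and the monotonicity of `a` makes the gradients a Cauchy sequence.
-/

open scoped NNReal

noncomputable section

section LpNorm

variable {X E : Type*} [MeasurableSpace X] {μ : Measure X} [NormedAddCommGroup E] {q : ℝ}

theorem integrable_norm_rpow_coeFn (hq : 0 < q) (f : Lp E (ENNReal.ofReal q) μ) :
    Integrable (fun x => ‖f x‖ ^ q) μ := by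
  have h := (Lp.memLp f).integrable_norm_rpow (by simpa using hq) ENNReal.ofReal_ne_top
  rwa [ENNReal.toReal_ofReal hq.le] at h

theorem norm_rpow_eq_integral_norm_rpow (hq : 0 < q) (f : Lp E (ENNReal.ofReal q) μ) :
    ‖f‖ ^ q = ∫ x, ‖f x‖ ^ q ∂μ := by
  have h := (Lp.memLp f).eLpNorm_eq_integral_rpow_norm (by simpa using hq) ENNReal.ofReal_ne_top
  have hn : 0 ≤ ∫ x, ‖f x‖ ^ q ∂μ := integral_nonneg fun x => by positivity
  rw [Lp.norm_def, h, ENNReal.toReal_ofReal_eq_iff.2 (by positivity), ENNReal.toReal_ofReal hq.le,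
    ← Real.rpow_mul hn, inv_mul_cancel₀ hq.ne', Real.rpow_one]

theorem ennreal_ofReal_holderConjugate {q q' : ℝ} (hq : q.HolderConjugate q') :
    ENNReal.HolderConjugate (ENNReal.ofReal q) (ENNReal.ofReal q') := by
  rw [ENNReal.holderConjugate_iff, ← ENNReal.ofReal_inv_of_pos hq.pos,
    ← ENNReal.ofReal_inv_of_pos hq.symm.pos, ← ENNReal.ofReal_add hq.inv_nonneg hq.symm.inv_nonneg,
    hq.inv_add_inv_eq_one, ENNReal.ofReal_one]

theorem add_rpow_le_two_rpow_mul {a b s : ℝ} (ha : 0 ≤ a) (hb : 0 ≤ b) (hs : 0 ≤ s) :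
    (a + b) ^ s ≤ 2 ^ s * (a ^ s + b ^ s) := by
  wlog hab : a ≤ b generalizing a b
  · rw [add_comm a, add_comm (a ^ s)]
    exact this hb ha (le_of_not_ge hab)
  calc (a + b) ^ s ≤ (2 * b) ^ s := Real.rpow_le_rpow (by positivity) (by linarith) hs
    _ = 2 ^ s * b ^ s := Real.mul_rpow (by norm_num) hb
    _ ≤ 2 ^ s * (a ^ s + b ^ s) := by
      gcongr
      exact le_add_of_nonneg_left (Real.rpow_nonneg ha s)

theorem tendsto_integral_zero_of_le_add {D V : ℕ → X → ℝ} {g : X → ℝ}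
    (hD : ∀ n, Integrable (D n) μ) (hV : ∀ n, Integrable (V n) μ) (hg : Integrable g μ)
    (hD0 : ∀ n x, 0 ≤ D n x) (hDle : ∀ n, ∀ᵐ x ∂μ, D n x ≤ g x + V n x)
    (hV0 : ∀ n x, 0 ≤ V n x) (hVlim : Tendsto (fun n => ∫ x, V n x ∂μ) atTop (𝓝 0))
    (hDlim : ∀ᵐ x ∂μ, Tendsto (fun n => D n x) atTop (𝓝 0)) :
    Tendsto (fun n => ∫ x, D n x ∂μ) atTop (𝓝 0) := by
  have hint : ∀ n, Integrable (fun x => max (D n x - V n x) 0) μ :=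
    fun n => ((hD n).sub (hV n)).pos_part
  have hpos_part : Tendsto (fun n => ∫ x, max (D n x - V n x) 0 ∂μ) atTop (𝓝 (∫ _, 0 ∂μ)) := by
    refine tendsto_integral_of_dominated_convergence (fun x => |g x|)
      (fun n => (hint n).aestronglyMeasurable) hg.abs (fun n => ?_) ?_
    · filter_upwards [hDle n] with x hx
      rw [Real.norm_of_nonneg (le_max_right _ _)]
      exact max_le ((by linarith : D n x - V n x ≤ g x).trans (le_abs_self _)) (abs_nonneg _)
    · filter_upwards [hDlim] with x hx
      exact squeeze_zero (fun n => le_max_right _ _)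
        (fun n => max_le (sub_le_self _ (hV0 n x)) (hD0 n x)) hx
  rw [integral_zero] at hpos_part
  refine squeeze_zero (fun n => integral_nonneg (hD0 n)) (fun n => ?_)
    (by simpa using hpos_part.add hVlim)
  rw [← integral_add (hint n) (hV n)]
  exact integral_mono (hD n) ((hint n).add (hV n))
    fun x => sub_le_iff_le_add.1 (le_max_left _ _)

end LpNorm

section Nemytskii

variable {X : Type*} [MeasurableSpace X] {μ : Measure X}

theorem aestronglyMeasurable_of_caratheodory {E F : Type*} [TopologicalSpace E]
    [TopologicalSpace F] [TopologicalSpace.PseudoMetrizableSpace F] {h : X → E → F} {u : X → E}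
    (hm : ∀ ξ, AEStronglyMeasurable (fun x => h x ξ) μ) (hc : ∀ᵐ x ∂μ, Continuous (h x))
    (hu : AEStronglyMeasurable u μ) : AEStronglyMeasurable (fun x => h x (u x)) μ := by
  obtain ⟨v, hv, huv⟩ := hu
  have hsimple : ∀ s : SimpleFunc X E, AEStronglyMeasurable (fun x => h x (s x)) μ := by
    intro s
    have hcover : (⋃ y : s.range, s ⁻¹' {(y : E)}) = univ :=
      eq_univ_of_forall fun x => mem_iUnion.2 ⟨⟨s x, s.mem_range_self x⟩, rfl⟩
    rw [← Measure.restrict_univ (μ := μ), ← hcover, aestronglyMeasurable_iUnion_iff]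
    refine fun y => (hm y).restrict.congr ?_
    filter_upwards [ae_restrict_mem (s.measurableSet_fiber y)] with x hx
    rw [mem_singleton_iff.1 hx]
  have hcomp_v : AEStronglyMeasurable (fun x => h x (v x)) μ := by
    refine aestronglyMeasurable_of_tendsto_ae atTop (fun n => hsimple (hv.approx n)) ?_
    filter_upwards [hc] with x hx
    exact (hx.tendsto _).comp (hv.tendsto_approx x)
  exact hcomp_v.congr (huv.mono fun x hx => congrArg (h x) hx.symm)

variable {E F : Type*} [NormedAddCommGroup E] [NormedAddCommGroup F] {q s : ℝ} {h : X → E → F}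

/-- A Carathéodory function whose growth makes the superposition operator `u ↦ h(·, u)` map
`L^q(μ)` into `L^s(μ)` when `μ` is finite. -/
structure IsNemytskii (μ : Measure X) (q s : ℝ) (h : X → E → F) : Prop where
  aestronglyMeasurable : ∀ ξ, AEStronglyMeasurable (fun x => h x ξ) μ
  continuous : ∀ᵐ x ∂μ, Continuous (h x)
  growth : ∃ A, ∀ᵐ x ∂μ, ∀ ξ, ‖h x ξ‖ ^ s ≤ A * (1 + ‖ξ‖ ^ q)

theorem IsNemytskii.of_norm_le (hq : q.HolderConjugate s)
    (hm : ∀ ξ, AEStronglyMeasurable (fun x => h x ξ) μ) (hc : ∀ᵐ x ∂μ, Continuous (h x)) {A : ℝ}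
    (hA : ∀ᵐ x ∂μ, ∀ ξ, ‖h x ξ‖ ≤ A * (1 + ‖ξ‖ ^ (q - 1))) : IsNemytskii μ q s h := by
  refine ⟨hm, hc, |A| ^ s * 2 ^ s, hA.mono fun x hx ξ => ?_⟩
  have hle : ‖h x ξ‖ ≤ |A| * (1 + ‖ξ‖ ^ (q - 1)) :=
    (hx ξ).trans (mul_le_mul_of_nonneg_right (le_abs_self A) (by positivity))
  calc ‖h x ξ‖ ^ s ≤ (|A| * (1 + ‖ξ‖ ^ (q - 1))) ^ s :=
        Real.rpow_le_rpow (norm_nonneg _) hle hq.symm.nonneg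
    _ = |A| ^ s * (1 + ‖ξ‖ ^ (q - 1)) ^ s := Real.mul_rpow (abs_nonneg A) (by positivity)
    _ ≤ |A| ^ s * (2 ^ s * (1 ^ s + (‖ξ‖ ^ (q - 1)) ^ s)) := by
      gcongr
      exact add_rpow_le_two_rpow_mul zero_le_one (by positivity) hq.symm.nonneg
    _ = |A| ^ s * 2 ^ s * (1 + ‖ξ‖ ^ q) := by
      rw [Real.one_rpow, ← Real.rpow_mul (norm_nonneg ξ), hq.sub_one_mul_conj, mul_assoc]

theorem IsNemytskii.aestronglyMeasurable_comp (hh : IsNemytskii μ q s h) {u : X → E}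
    (hu : AEStronglyMeasurable u μ) : AEStronglyMeasurable (fun x => h x (u x)) μ :=
  aestronglyMeasurable_of_caratheodory hh.aestronglyMeasurable hh.continuous hu

theorem IsNemytskii.exists_norm_rpow_le (hh : IsNemytskii μ q s h) (hq : 0 ≤ q) :
    ∃ A, ∀ᵐ x ∂μ, ∀ ξ R, ‖ξ‖ ≤ R → ‖h x ξ‖ ^ s ≤ A * (1 + R ^ q) := by
  obtain ⟨A, hA⟩ := hh.growth
  refine ⟨|A|, hA.mono fun x hx ξ R hR => (hx ξ).trans ?_⟩
  calc A * (1 + ‖ξ‖ ^ q) ≤ |A| * (1 + ‖ξ‖ ^ q) :=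
        mul_le_mul_of_nonneg_right (le_abs_self A) (by positivity)
    _ ≤ |A| * (1 + R ^ q) := by gcongr

theorem IsNemytskii.exists_norm_sub_rpow_le (hh : IsNemytskii μ q s h) (hq : 0 ≤ q) (hs : 0 ≤ s) :
    ∃ K, ∀ᵐ x ∂μ, ∀ ξ η,
      ‖h x η - h x ξ‖ ^ s ≤ K * (1 + ‖ξ‖ ^ q) + K * ‖η - ξ‖ ^ q := by
  obtain ⟨A, hA⟩ := hh.growth
  refine ⟨2 ^ s * (|A| * (2 ^ q + 2)), hA.mono fun x hx ξ η => ?_⟩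
  have hle : ∀ ζ, ‖h x ζ‖ ^ s ≤ |A| * (1 + ‖ζ‖ ^ q) := fun ζ =>
    (hx ζ).trans (mul_le_mul_of_nonneg_right (le_abs_self A) (by positivity))
  have hη : ‖η‖ ^ q ≤ 2 ^ q * (‖ξ‖ ^ q + ‖η - ξ‖ ^ q) :=
    (Real.rpow_le_rpow (norm_nonneg _) (norm_le_norm_add_norm_sub' η ξ) hq).trans
      (add_rpow_le_two_rpow_mul (norm_nonneg _) (norm_nonneg _) hq)
  have hsum : 2 + ‖η‖ ^ q + ‖ξ‖ ^ q ≤ (2 ^ q + 2) * (1 + ‖ξ‖ ^ q) + (2 ^ q + 2) * ‖η - ξ‖ ^ q := by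
    have h2q : 0 < (2 : ℝ) ^ q := by positivity
    linarith [Real.rpow_nonneg (norm_nonneg ξ) q, Real.rpow_nonneg (norm_nonneg (η - ξ)) q]
  calc ‖h x η - h x ξ‖ ^ s ≤ (‖h x η‖ + ‖h x ξ‖) ^ s :=
        Real.rpow_le_rpow (norm_nonneg _) (norm_sub_le _ _) hs
    _ ≤ 2 ^ s * (‖h x η‖ ^ s + ‖h x ξ‖ ^ s) :=
        add_rpow_le_two_rpow_mul (norm_nonneg _) (norm_nonneg _) hs
    _ ≤ 2 ^ s * (|A| * (1 + ‖η‖ ^ q) + |A| * (1 + ‖ξ‖ ^ q)) := by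
        gcongr <;> exact hle _
    _ = 2 ^ s * (|A| * (2 + ‖η‖ ^ q + ‖ξ‖ ^ q)) := by ring
    _ ≤ 2 ^ s * (|A| * ((2 ^ q + 2) * (1 + ‖ξ‖ ^ q) + (2 ^ q + 2) * ‖η - ξ‖ ^ q)) :=
        mul_le_mul_of_nonneg_left (mul_le_mul_of_nonneg_left hsum (abs_nonneg A)) (by positivity)
    _ = _ := by ring

section Operator

variable [IsFiniteMeasure μ] [hq : Fact (1 ≤ ENNReal.ofReal q)] [hs : Fact (1 ≤ ENNReal.ofReal s)]

theorem IsNemytskii.memLp (hh : IsNemytskii μ q s h) (u : Lp E (ENNReal.ofReal q) μ) :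
    MemLp (fun x => h x (u x)) (ENNReal.ofReal s) μ := by
  have hq1 := ENNReal.one_le_ofReal.1 hq.out
  have hs1 := ENNReal.one_le_ofReal.1 hs.out
  obtain ⟨A, hA⟩ := hh.growth
  have hm := hh.aestronglyMeasurable_comp (Lp.aestronglyMeasurable u)
  refine (integrable_norm_rpow_iff hm (by simp; linarith) ENNReal.ofReal_ne_top).1 ?_
  rw [ENNReal.toReal_ofReal (by linarith)]
  refine (((integrable_const 1).add
    (integrable_norm_rpow_coeFn (by linarith) u)).const_mul A).mono'
    (hm.norm.aemeasurable.pow_const s).aestronglyMeasurable ?_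
  filter_upwards [hA] with x hx
  rw [Real.norm_of_nonneg (by positivity)]
  exact hx (u x)

/-- The superposition operator `u ↦ h(·, u)` from `L^q` to `L^s`. -/
def IsNemytskii.op (hh : IsNemytskii μ q s h) (u : Lp E (ENNReal.ofReal q) μ) :
    Lp F (ENNReal.ofReal s) μ :=
  (hh.memLp u).toLp _

theorem IsNemytskii.coeFn_op (hh : IsNemytskii μ q s h) (u : Lp E (ENNReal.ofReal q) μ) :
    hh.op u =ᵐ[μ] fun x => h x (u x) :=
  MemLp.coeFn_toLp _

theorem IsNemytskii.continuous_op (hh : IsNemytskii μ q s h) : Continuous hh.op := by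
  have hq0 : 0 < q := zero_lt_one.trans_le (ENNReal.one_le_ofReal.1 hq.out)
  have hs0 : 0 < s := zero_lt_one.trans_le (ENNReal.one_le_ofReal.1 hs.out)
  obtain ⟨K, hK⟩ := hh.exists_norm_sub_rpow_le hq0.le hs0.le
  refine continuous_iff_seqContinuous.2 fun u u₀ hu => tendsto_of_subseq_tendsto fun k hk => ?_
  obtain ⟨m, hm, hae⟩ := (tendstoInMeasure_of_tendsto_Lp (hu.comp hk)).exists_seq_tendsto_ae
  refine ⟨m, ?_⟩
  set v := fun n => u (k (m n))
  have hv : Tendsto v atTop (𝓝 u₀) := hu.comp (hk.comp hm.tendsto_atTop)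
  have hop : ∀ n, ∀ᵐ x ∂μ, ‖(hh.op (v n) - hh.op u₀) x‖ = ‖h x (v n x) - h x (u₀ x)‖ := by
    intro n
    filter_upwards [Lp.coeFn_sub (hh.op (v n)) (hh.op u₀), hh.coeFn_op (v n),
      hh.coeFn_op u₀] with x h1 h2 h3
    rw [h1, Pi.sub_apply, h2, h3]
  have hV : Tendsto (fun n => ∫ x, |K| * ‖(v n - u₀) x‖ ^ q ∂μ) atTop (𝓝 0) := by
    simp_rw [integral_const_mul, ← norm_rpow_eq_integral_norm_rpow hq0]
    simpa [hq0.ne'] using ((tendsto_iff_norm_sub_tendsto_zero.1 hv).rpow_const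
      (Or.inr hq0.le)).const_mul |K|
  have hD : Tendsto (fun n => ∫ x, ‖(hh.op (v n) - hh.op u₀) x‖ ^ s ∂μ) atTop (𝓝 0) := by
    refine tendsto_integral_zero_of_le_add (g := fun x => |K| * (1 + ‖u₀ x‖ ^ q))
      (V := fun n x => |K| * ‖(v n - u₀) x‖ ^ q)
      (fun n => integrable_norm_rpow_coeFn hs0 _)
      (fun n => (integrable_norm_rpow_coeFn hq0 _).const_mul _)
      (((integrable_const 1).add (integrable_norm_rpow_coeFn hq0 u₀)).const_mul _)
      (fun n x => by positivity) (fun n => ?_) (fun n x => by positivity) hV ?_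
    · filter_upwards [hK, hop n, Lp.coeFn_sub (v n) u₀] with x hx hx' hsub
      rw [hx', hsub, Pi.sub_apply]
      refine (hx _ _).trans ?_
      gcongr <;> exact le_abs_self K
    · filter_upwards [hh.continuous, hae, ae_all_iff.2 hop] with x hc hx hx'
      simp_rw [hx']
      simpa [hs0.ne'] using ((tendsto_iff_norm_sub_tendsto_zero.1
        ((hc.tendsto (u₀ x)).comp hx)).rpow_const (Or.inr hs0.le))
  refine tendsto_iff_norm_sub_tendsto_zero.2 ?_
  simp_rw [← norm_rpow_eq_integral_norm_rpow hs0] at hD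
  simpa [hs0.ne', Real.rpow_rpow_inv] using hD.rpow_const (p := s⁻¹) (Or.inr (by positivity))

end Operator

end Nemytskii

section LineDeriv

theorem hasFDerivAt_of_hasLineDerivAt {W : Type*} [NormedAddCommGroup W] [NormedSpace ℝ W]
    {f : W → ℝ} {f' : W → W →L[ℝ] ℝ} (hf : ∀ u v, HasLineDerivAt ℝ f (f' u v) u v)
    (hf' : Continuous f') (u : W) : HasFDerivAt f (f' u) u := by
  refine HasFDerivAt.of_isLittleO (Asymptotics.isLittleO_iff.2 fun ε hε => ?_)
  obtain ⟨δ, hδ, hδ'⟩ := Metric.continuous_iff.1 hf' u ε hε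
  filter_upwards [Metric.ball_mem_nhds u hδ] with y hy
  set v := y - u
  have hline : ∀ t : ℝ, HasDerivAt (fun t : ℝ => f (u + t • v) - t * f' u v)
      (f' (u + t • v) v - f' u v) t := by
    intro t
    have hzero : HasDerivAt (fun τ : ℝ => f (u + t • v + τ • v)) (f' (u + t • v) v) 0 :=
      hf (u + t • v) v
    have hshift := hzero.scomp_of_eq t
      ((hasDerivAt_id t).sub_const t) (by simp)
    refine HasDerivAt.sub ?_ (by simpa using (hasDerivAt_id t).mul_const (f' u v))
    simpa [Function.comp_def, add_assoc, ← add_smul] using hshift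
  have hbound : ∀ t ∈ Ico (0 : ℝ) 1, ‖f' (u + t • v) v - f' u v‖ ≤ ε * ‖v‖ := by
    intro t ht
    have hdist : dist (u + t • v) u < δ := by
      rw [dist_self_add_left, norm_smul, Real.norm_of_nonneg ht.1]
      exact (mul_le_of_le_one_left (norm_nonneg _) ht.2.le).trans_lt (mem_ball_iff_norm.1 hy)
    rw [← _root_.sub_apply]
    refine (ContinuousLinearMap.le_opNorm _ _).trans ?_
    gcongr
    exact (dist_eq_norm (f' (u + t • v)) (f' u) ▸ hδ' _ hdist).le
  have hincr : f y - f u - f' u v =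
      (f (u + (1 : ℝ) • v) - 1 * f' u v) - (f (u + (0 : ℝ) • v) - 0 * f' u v) := by
    rw [one_smul, zero_smul, add_zero, add_sub_cancel]
    ring
  exact hincr ▸ norm_image_sub_le_of_norm_deriv_le_segment_01'
    (fun t _ => (hline t).hasDerivWithinAt) hbound

end LineDeriv

section Pairing

theorem abs_inner_le_of_norm_rpow_le {E : Type*} [NormedAddCommGroup E] [InnerProductSpace ℝ E]
    {q s B : ℝ} (hq : q.HolderConjugate s) {η : E} (hη : ‖η‖ ^ s ≤ B) (v : E) :
    |inner ℝ η v| ≤ B + ‖v‖ ^ q :=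
  calc |inner ℝ η v| ≤ ‖v‖ * ‖η‖ := by rw [mul_comm]; exact abs_real_inner_le_norm η v
    _ ≤ ‖v‖ ^ q / q + ‖η‖ ^ s / s :=
      Real.young_inequality_of_nonneg (norm_nonneg _) (norm_nonneg _) hq
    _ ≤ ‖v‖ ^ q + ‖η‖ ^ s := by
      gcongr
      · exact div_le_self (by positivity) hq.lt.le
      · exact div_le_self (by positivity) hq.symm.lt.le
    _ ≤ B + ‖v‖ ^ q := by linarith

variable {X E : Type*} [MeasurableSpace X] {μ : Measure X} [NormedAddCommGroup E]
  [InnerProductSpace ℝ E] {q s : ℝ} {h : X → E → E} [IsFiniteMeasure μ]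
  [Fact (1 ≤ ENNReal.ofReal q)] [Fact (1 ≤ ENNReal.ofReal s)]

/-- The functional `v ↦ ∫ ⟪h(·, u), v⟫` on `L^q`. -/
def IsNemytskii.pairing (hh : IsNemytskii μ q s h) (hq : q.HolderConjugate s)
    (u : Lp E (ENNReal.ofReal q) μ) : Lp E (ENNReal.ofReal q) μ →L[ℝ] ℝ :=
  haveI := ennreal_ofReal_holderConjugate hq.symm
  (innerSL ℝ).lpPairing μ (ENNReal.ofReal s) (ENNReal.ofReal q) (hh.op u)

theorem IsNemytskii.pairing_apply (hh : IsNemytskii μ q s h) (hq : q.HolderConjugate s)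
    (u v : Lp E (ENNReal.ofReal q) μ) :
    hh.pairing hq u v = ∫ x, inner ℝ (h x (u x)) (v x) ∂μ := by
  have := ennreal_ofReal_holderConjugate hq.symm
  rw [IsNemytskii.pairing, ContinuousLinearMap.lpPairing_eq_integral]
  exact integral_congr_ae ((hh.coeFn_op u).mono fun x hx => congrArg (inner ℝ · (v x)) hx)

theorem IsNemytskii.continuous_pairing (hh : IsNemytskii μ q s h) (hq : q.HolderConjugate s) :
    Continuous (hh.pairing hq) :=
  (ContinuousLinearMap.continuous _).comp hh.continuous_op

theorem IsNemytskii.integrable_inner (hh : IsNemytskii μ q s h) (hq : q.HolderConjugate s)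
    (u v : Lp E (ENNReal.ofReal q) μ) :
    Integrable (fun x => inner ℝ (h x (u x)) (v x)) μ := by
  have := ennreal_ofReal_holderConjugate hq.symm
  exact memLp_one_iff_integrable.1
    ((innerSL ℝ (E := E)).memLp_of_bilin (r := 1) (hh.memLp u) (Lp.memLp v))

end Pairing

section Potential

variable {X E : Type*} [NormedAddCommGroup E] [InnerProductSpace ℝ E] [CompleteSpace E]

theorem hasDerivAt_line_of_hasGradientAt {H : E → ℝ} {h : E → E} (hH : ∀ ξ, HasGradientAt H (h ξ) ξ)
    (ξ v : E) (t : ℝ) :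
    HasDerivAt (fun t : ℝ => H (ξ + t • v)) (inner ℝ (h (ξ + t • v)) v) t := by
  have hline : HasDerivAt (fun t : ℝ => ξ + t • v) v t := by
    simpa using ((hasDerivAt_id t).smul_const v).const_add ξ
  have h := (hH (ξ + t • v)).hasFDerivAt.comp_hasDerivAt t hline
  rwa [InnerProductSpace.toDual_apply_apply] at h

theorem integral_inner_smul_eq_sub {H : E → ℝ} {h : E → E} (hH : ∀ ξ, HasGradientAt H (h ξ) ξ)
    (hh : Continuous h) (ξ : E) :
    ∫ t in (0 : ℝ)..1, inner ℝ (h (t • ξ)) ξ = H ξ - H 0 := by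
  have hline : ∀ t : ℝ, HasDerivAt (fun t : ℝ => H (t • ξ)) (inner ℝ (h (t • ξ)) ξ) t := by
    simpa using hasDerivAt_line_of_hasGradientAt hH 0 ξ
  simpa using intervalIntegral.integral_eq_sub_of_hasDerivAt (fun t _ => hline t)
    ((by fun_prop : Continuous fun t : ℝ => inner ℝ (h (t • ξ)) ξ).intervalIntegrable 0 1)

variable [MeasurableSpace X] {μ : Measure X} {q s : ℝ} {h : X → E → E} {H : X → E → ℝ}

/-- `H(x, ·)` is the primitive of the vector field `h(x, ·)` that vanishes at the origin. -/
structure IsPotential (μ : Measure X) (H : X → E → ℝ) (h : X → E → E) : Prop where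
  zero : ∀ᵐ x ∂μ, H x 0 = 0
  hasGradientAt : ∀ᵐ x ∂μ, ∀ ξ, HasGradientAt (H x) (h x ξ) ξ

theorem IsPotential.aestronglyMeasurable_comp (hH : IsPotential μ H h) (hh : IsNemytskii μ q s h)
    [SFinite μ] {u : X → E} (hu : AEStronglyMeasurable u μ) :
    AEStronglyMeasurable (fun x => H x (u x)) μ := by
  set I := (volume : Measure ℝ).restrict (Ioc 0 1)
  have hfield : AEStronglyMeasurable (fun z : X × ℝ => h z.1 (z.2 • u z.1)) (μ.prod I) :=
    aestronglyMeasurable_of_caratheodory (h := fun z : X × ℝ => h z.1)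
      (fun ξ => (hh.aestronglyMeasurable ξ).comp_fst)
      (Measure.quasiMeasurePreserving_fst.ae hh.continuous)
      (measurable_snd.aestronglyMeasurable.smul hu.comp_fst)
  refine (hfield.inner hu.comp_fst).integral_prod_right'.congr ?_
  filter_upwards [hH.zero, hH.hasGradientAt, hh.continuous] with x h0 hgrad hcont
  rw [← intervalIntegral.integral_of_le zero_le_one,
    integral_inner_smul_eq_sub hgrad hcont, h0, sub_zero]

theorem IsPotential.exists_abs_le (hH : IsPotential μ H h) (hh : IsNemytskii μ q s h)
    (hq : q.HolderConjugate s) :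
    ∃ A, ∀ᵐ x ∂μ, ∀ ξ, |H x ξ| ≤ A * (1 + ‖ξ‖ ^ q) + ‖ξ‖ ^ q := by
  obtain ⟨A, hA⟩ := hh.exists_norm_rpow_le hq.nonneg
  refine ⟨A, ?_⟩
  filter_upwards [hA, hH.zero, hH.hasGradientAt] with x hgrowth h0 hgrad ξ
  have hbound : ∀ t ∈ Ico (0 : ℝ) 1,
      ‖inner ℝ (h x (0 + t • ξ)) ξ‖ ≤ A * (1 + ‖ξ‖ ^ q) + ‖ξ‖ ^ q := by
    refine fun t ht => abs_inner_le_of_norm_rpow_le hq (hgrowth _ _ ?_) ξ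
    rw [zero_add, norm_smul, Real.norm_of_nonneg ht.1]
    exact mul_le_of_le_one_left (norm_nonneg _) ht.2.le
  simpa [h0] using norm_image_sub_le_of_norm_deriv_le_segment_01'
    (fun t _ => (hasDerivAt_line_of_hasGradientAt hgrad 0 ξ t).hasDerivWithinAt) hbound

variable [IsFiniteMeasure μ]

theorem IsPotential.integrable (hH : IsPotential μ H h) (hh : IsNemytskii μ q s h)
    (hq : q.HolderConjugate s) (u : Lp E (ENNReal.ofReal q) μ) :
    Integrable (fun x => H x (u x)) μ := by
  obtain ⟨A, hA⟩ := hH.exists_abs_le hh hq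
  have hu := integrable_norm_rpow_coeFn hq.pos u
  exact ((((integrable_const 1).add hu).const_mul A).add hu).mono'
    (hH.aestronglyMeasurable_comp hh (Lp.aestronglyMeasurable u)) (hA.mono fun x hx => hx (u x))

variable [Fact (1 ≤ ENNReal.ofReal q)] [Fact (1 ≤ ENNReal.ofReal s)]

theorem IsPotential.hasLineDerivAt_integral (hH : IsPotential μ H h) (hh : IsNemytskii μ q s h)
    (hq : q.HolderConjugate s) (u v : Lp E (ENNReal.ofReal q) μ) :
    HasLineDerivAt ℝ (fun w : Lp E (ENNReal.ofReal q) μ => ∫ x, H x (w x) ∂μ)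
      (hh.pairing hq u v) u v := by
  obtain ⟨A, hA⟩ := hh.exists_norm_rpow_le hq.nonneg
  have hu := Lp.aestronglyMeasurable u
  have hv := Lp.aestronglyMeasurable v
  have hbound : Integrable (fun x => A * (1 + (‖u x‖ + ‖v x‖) ^ q) + ‖v x‖ ^ q) μ := by
    have hsum := ((Lp.memLp u).norm.add (Lp.memLp v).norm).integrable_norm_rpow
      (by simpa using hq.pos) ENNReal.ofReal_ne_top
    rw [ENNReal.toReal_ofReal hq.nonneg] at hsum
    refine (((integrable_const 1).add (hsum.congr ?_)).const_mul A).add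
      (integrable_norm_rpow_coeFn hq.pos v)
    exact .of_forall fun x => by
      simp only [Pi.add_apply, Real.norm_of_nonneg (add_nonneg (norm_nonneg (u x)) (norm_nonneg _))]
  have hderiv := (hasDerivAt_integral_of_dominated_loc_of_deriv_le (μ := μ) (x₀ := (0 : ℝ))
    (F := fun t x => H x (u x + t • v x)) (F' := fun t x => inner ℝ (h x (u x + t • v x)) (v x))
    (Metric.ball_mem_nhds 0 one_pos)
    (.of_forall fun t => hH.aestronglyMeasurable_comp hh (hu.add (hv.const_smul t)))
    (by simpa using hH.integrable hh hq u)
    (by simpa using (hh.integrable_inner hq u v).aestronglyMeasurable) ?_ hbound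
    (hH.hasGradientAt.mono fun x hx t _ => hasDerivAt_line_of_hasGradientAt hx (u x) (v x) t)).2
  · rw [HasLineDerivAt, hh.pairing_apply]
    simp only [zero_smul, add_zero] at hderiv
    refine hderiv.congr_of_eventuallyEq (.of_forall fun t => integral_congr_ae ?_)
    filter_upwards [Lp.coeFn_add u (t • v), Lp.coeFn_smul t v] with x hadd hsmul
    rw [hadd, Pi.add_apply, hsmul, Pi.smul_apply]
  · filter_upwards [hA] with x hx t ht
    refine abs_inner_le_of_norm_rpow_le hq (hx _ _ ((norm_add_le _ _).trans ?_)) (v x)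
    rw [norm_smul]
    gcongr
    exact mul_le_of_le_one_left (norm_nonneg _) (mem_ball_zero_iff.1 ht).le

theorem IsPotential.hasFDerivAt_integral (hH : IsPotential μ H h) (hh : IsNemytskii μ q s h)
    (hq : q.HolderConjugate s) (u : Lp E (ENNReal.ofReal q) μ) :
    HasFDerivAt (fun w : Lp E (ENNReal.ofReal q) μ => ∫ x, H x (w x) ∂μ) (hh.pairing hq u) u :=
  hasFDerivAt_of_hasLineDerivAt (hH.hasLineDerivAt_integral hh hq) (hh.continuous_pairing hq) u

end Potential

theorem hasFDerivAt_norm {E : Type*} [NormedAddCommGroup E] [InnerProductSpace ℝ E] {ξ : E}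
    (hξ : ξ ≠ 0) : HasFDerivAt (fun ζ : E => ‖ζ‖) (‖ξ‖⁻¹ • innerSL ℝ ξ) ξ := by
  have h := (hasStrictFDerivAt_norm_sq ξ).hasFDerivAt.sqrt (by simpa using hξ)
  simp only [Real.sqrt_sq (norm_nonneg _)] at h
  refine h.congr_fderiv ?_
  ext v
  simp
  field_simp

section RadialField

variable {N : ℕ} {b : ℝ → ℝ}

theorem norm_aMap (b : ℝ → ℝ) (ξ : RN N) : ‖aMap N b ξ‖ = |‖ξ‖ * b ‖ξ‖| := by
  rw [aMap, norm_smul, abs_mul, abs_norm, Real.norm_eq_abs, mul_comm]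

theorem inner_aMap_self (b : ℝ → ℝ) (ξ : RN N) :
    inner ℝ (aMap N b ξ) ξ = ‖ξ‖ * (‖ξ‖ * b ‖ξ‖) := by
  rw [aMap, real_inner_smul_left, real_inner_self_eq_norm_sq]
  ring

theorem inner_aMap_sub (b : ℝ → ℝ) (ξ η : RN N) :
    inner ℝ (aMap N b ξ - aMap N b η) (ξ - η) =
      (‖ξ‖ * b ‖ξ‖ - ‖η‖ * b ‖η‖) * (‖ξ‖ - ‖η‖) +
        (b ‖ξ‖ + b ‖η‖) * (‖ξ‖ * ‖η‖ - inner ℝ ξ η) := by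
  simp only [aMap, inner_sub_left, inner_sub_right, real_inner_smul_left,
    real_inner_self_eq_norm_sq, real_inner_comm ξ η]
  ring

theorem nonneg_of_monotoneOn_mul (hb : MonotoneOn (fun t => t * b t) (Ici 0)) {t : ℝ}
    (ht : 0 < t) : 0 ≤ b t := by
  have h := hb (mem_Ici.2 le_rfl) ht.le ht.le
  simp only [zero_mul] at h
  exact nonneg_of_mul_nonneg_right h ht

theorem add_mul_norm_mul_sub_inner_nonneg (hb : MonotoneOn (fun t => t * b t) (Ici 0))
    (ξ η : RN N) : 0 ≤ (b ‖ξ‖ + b ‖η‖) * (‖ξ‖ * ‖η‖ - inner ℝ ξ η) := by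
  rcases eq_or_ne ξ 0 with rfl | hξ
  · simp
  rcases eq_or_ne η 0 with rfl | hη
  · simp
  exact mul_nonneg (add_nonneg (nonneg_of_monotoneOn_mul hb (norm_pos_iff.2 hξ))
    (nonneg_of_monotoneOn_mul hb (norm_pos_iff.2 hη))) (sub_nonneg.2 (real_inner_le_norm ξ η))

theorem inner_aMap_sub_nonneg (hb : MonotoneOn (fun t => t * b t) (Ici 0)) (ξ η : RN N) :
    0 ≤ inner ℝ (aMap N b ξ - aMap N b η) (ξ - η) := by
  rw [inner_aMap_sub]
  refine add_nonneg ?_ (add_mul_norm_mul_sub_inner_nonneg hb ξ η)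
  rcases le_total ‖ξ‖ ‖η‖ with h | h
  · exact mul_nonneg_of_nonpos_of_nonpos
      (sub_nonpos.2 (hb (norm_nonneg ξ) (norm_nonneg η) h)) (sub_nonpos.2 h)
  · exact mul_nonneg (sub_nonneg.2 (hb (norm_nonneg η) (norm_nonneg ξ) h)) (sub_nonneg.2 h)

theorem inner_aMap_sub_pos (hb : StrictMonoOn (fun t => t * b t) (Ici 0)) {ξ η : RN N}
    (hne : ξ ≠ η) : 0 < inner ℝ (aMap N b ξ - aMap N b η) (ξ - η) := by
  rcases lt_trichotomy ‖ξ‖ ‖η‖ with hlt | heq | hgt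
  · rw [inner_aMap_sub]
    exact add_pos_of_pos_of_nonneg (mul_pos_of_neg_of_neg
      (sub_neg.2 (hb (norm_nonneg ξ) (norm_nonneg η) hlt)) (sub_neg.2 hlt))
      (add_mul_norm_mul_sub_inner_nonneg hb.monotoneOn ξ η)
  · have hξ : 0 < ‖ξ‖ := (norm_nonneg ξ).lt_of_ne fun h =>
      hne (by rw [norm_eq_zero.1 h.symm, norm_eq_zero.1 (heq.symm.trans h.symm)])
    have hpos : 0 < b ‖ξ‖ := by
      simpa [hξ] using hb (mem_Ici.2 le_rfl) hξ.le hξ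
    have hlt : inner ℝ ξ η < ‖ξ‖ * ‖η‖ := by
      rw [inner_lt_norm_mul_iff_real, heq]
      exact fun h => hne (smul_right_injective _ (heq ▸ hξ.ne') h)
    rw [inner_aMap_sub, ← heq, sub_self, zero_mul, zero_add]
    exact mul_pos (by positivity) (sub_pos.2 (heq ▸ hlt))
  · rw [inner_aMap_sub]
    exact add_pos_of_pos_of_nonneg (mul_pos
      (sub_pos.2 (hb (norm_nonneg η) (norm_nonneg ξ) hgt)) (sub_pos.2 hgt))
      (add_mul_norm_mul_sub_inner_nonneg hb.monotoneOn ξ η)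

theorem continuous_aMap (hb : ContinuousOn (fun t => t * b t) (Ici 0)) :
    Continuous (aMap N b) := by
  refine continuous_iff_continuousAt.2 fun ξ => ?_
  have hnorm : Continuous fun ζ : RN N => ‖ζ‖ * b ‖ζ‖ :=
    hb.comp_continuous continuous_norm fun ζ => norm_nonneg ζ
  rcases eq_or_ne ξ 0 with rfl | hξ
  · rw [ContinuousAt, show aMap N b 0 = 0 by simp [aMap], tendsto_zero_iff_norm_tendsto_zero]
    simp_rw [norm_aMap]
    simpa using (hnorm.tendsto 0).abs
  · have hquot : ContinuousAt (fun ζ : RN N => ‖ζ‖ * b ‖ζ‖ / ‖ζ‖) ξ :=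
      hnorm.continuousAt.div continuous_norm.continuousAt (norm_ne_zero_iff.2 hξ)
    refine (hquot.smul continuousAt_id).congr ?_
    filter_upwards [eventually_ne_nhds hξ] with ζ hζ
    simp [aMap, mul_div_cancel_left₀ _ (norm_ne_zero_iff.2 hζ)]

theorem hasDerivAt_integral_abs_mul (hb : ContinuousOn (fun t => t * b t) (Ici 0)) (t : ℝ) :
    HasDerivAt (fun t => ∫ s in (0 : ℝ)..t, |s| * b |s|) (|t| * b |t|) t := by
  have hcont : Continuous fun s : ℝ => |s| * b |s| :=
    hb.comp_continuous continuous_abs fun s => abs_nonneg s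
  exact intervalIntegral.integral_hasDerivAt_right (hcont.intervalIntegrable _ _)
    (hcont.stronglyMeasurableAtFilter _ _) hcont.continuousAt

theorem GFun_eq_integral_abs (b : ℝ → ℝ) (ξ : RN N) :
    GFun N b ξ = ∫ s in (0 : ℝ)..‖ξ‖, |s| * b |s| := by
  refine intervalIntegral.integral_congr fun s hs => ?_
  rw [uIcc_of_le (norm_nonneg ξ)] at hs
  simp only [abs_of_nonneg hs.1]

theorem hasGradientAt_GFun (hb : ContinuousOn (fun t => t * b t) (Ici 0)) (ξ : RN N) :
    HasGradientAt (GFun N b) (aMap N b ξ) ξ := by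
  have hderiv := hasDerivAt_integral_abs_mul hb
  rw [funext (GFun_eq_integral_abs b), hasGradientAt_iff_hasFDerivAt]
  rcases eq_or_ne ξ 0 with rfl | hξ
  · have hsmall := (hasDerivAt_iff_isLittleO.1 (hderiv 0)).comp_tendsto
      (by simpa using (continuous_norm (E := RN N)).tendsto 0)
    have hzero : InnerProductSpace.toDual ℝ (RN N) (aMap N b 0) = 0 := by simp [aMap]
    refine HasFDerivAt.of_isLittleO (Asymptotics.isLittleO_norm_right.1 ?_)
    rw [hzero]
    simpa [Function.comp_def] using hsmall
  · refine ((hderiv ‖ξ‖).comp_hasFDerivAt ξ (hasFDerivAt_norm hξ)).congr_fderiv ?_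
    ext v
    simp [aMap]
    field_simp [norm_ne_zero_iff.2 hξ]

end RadialField

section Homogeneous

variable {E : Type*} [NormedAddCommGroup E] {p : ℝ}

theorem isCompact_setOf_norm_rpow_add_eq_one [ProperSpace E] (hp : 0 < p) (δ : ℝ) :
    IsCompact {z : E × E | ‖z.1‖ ^ p + ‖z.2‖ ^ p = 1 ∧ δ ≤ ‖z.1 - z.2‖ ^ p} := by
  have hle : ∀ {a c : ℝ}, 0 ≤ a → 0 ≤ c → a ^ p + c ^ p = 1 → a ≤ 1 := by
    intro a c ha hc h
    refine (Real.rpow_le_rpow_iff ha zero_le_one hp).1 ?_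
    rw [Real.one_rpow]
    linarith [Real.rpow_nonneg hc p]
  refine (isCompact_closedBall (0 : E × E) 1).of_isClosed_subset ?_ fun z hz => ?_
  · have hpow : Continuous fun t : ℝ => t ^ p := Real.continuous_rpow_const hp.le
    have hfst : Continuous fun z : E × E => ‖z.1‖ ^ p := hpow.comp (by fun_prop)
    have hsnd : Continuous fun z : E × E => ‖z.2‖ ^ p := hpow.comp (by fun_prop)
    have hsub : Continuous fun z : E × E => ‖z.1 - z.2‖ ^ p := hpow.comp (by fun_prop)
    exact (isClosed_eq (hfst.add hsnd) continuous_const).inter (isClosed_le continuous_const hsub)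
  · rw [mem_closedBall_zero_iff, Prod.norm_def]
    exact max_le (hle (norm_nonneg _) (norm_nonneg _) hz.1)
      (hle (norm_nonneg _) (norm_nonneg _) (add_comm (‖z.1‖ ^ p) _ ▸ hz.1))

variable [InnerProductSpace ℝ E] [FiniteDimensional ℝ E]

theorem exists_norm_sub_rpow_le_of_norm_rpow_add_eq_one {T : E → E} (hp : 0 < p)
    (hT : Continuous T) (hmono : ∀ ξ η, ξ ≠ η → 0 < inner ℝ (T ξ - T η) (ξ - η)) {δ : ℝ}
    (hδ : 0 < δ) :
    ∃ C ≥ 0, ∀ ξ η, ‖ξ‖ ^ p + ‖η‖ ^ p = 1 →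
      ‖ξ - η‖ ^ p ≤ C * inner ℝ (T ξ - T η) (ξ - η) + δ := by
  have hne : ∀ z : E × E, δ ≤ ‖z.1 - z.2‖ ^ p → z.1 ≠ z.2 := by
    intro z hz heq
    rw [heq, sub_self, norm_zero, Real.zero_rpow hp.ne'] at hz
    exact hδ.not_ge hz
  have hnonneg : ∀ ξ η, 0 ≤ inner ℝ (T ξ - T η) (ξ - η) := fun ξ η => by
    rcases eq_or_ne ξ η with rfl | h
    · simp
    · exact (hmono ξ η h).le
  have := FiniteDimensional.proper_real E
  have hcompact := isCompact_setOf_norm_rpow_add_eq_one (E := E) hp δ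
  obtain ⟨C, hC⟩ := hcompact.exists_bound_of_continuousOn
    (f := fun z => ‖z.1 - z.2‖ ^ p / inner ℝ (T z.1 - T z.2) (z.1 - z.2)) <|
    ContinuousOn.div (Continuous.continuousOn (by fun_prop (disch := exact hp.le)))
      (Continuous.continuousOn (by fun_prop)) fun z hz => (hmono _ _ (hne z hz.2)).ne'
  refine ⟨max C 0, le_max_right _ _, fun ξ η hsum => ?_⟩
  rcases le_total (‖ξ - η‖ ^ p) δ with hle | hge
  · have := mul_nonneg (le_max_right C 0) (hnonneg ξ η)
    linarith
  · have hquot := (le_abs_self _).trans ((hC (ξ, η) ⟨hsum, hge⟩).trans (le_max_left C 0))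
    rw [div_le_iff₀ (hmono _ _ (hne (ξ, η) hge))] at hquot
    linarith

theorem exists_norm_sub_rpow_le_of_homogeneous {T : E → E} (hp : 0 < p) (hT : Continuous T)
    (hhom : ∀ c : ℝ, 0 < c → ∀ ξ, T (c • ξ) = c ^ (p - 1) • T ξ)
    (hmono : ∀ ξ η, ξ ≠ η → 0 < inner ℝ (T ξ - T η) (ξ - η)) {δ : ℝ} (hδ : 0 < δ) :
    ∃ C ≥ 0, ∀ ξ η,
      ‖ξ - η‖ ^ p ≤ C * inner ℝ (T ξ - T η) (ξ - η) + δ * (‖ξ‖ ^ p + ‖η‖ ^ p) := by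
  obtain ⟨C, hC0, hC⟩ := exists_norm_sub_rpow_le_of_norm_rpow_add_eq_one hp hT hmono hδ
  refine ⟨C, hC0, fun ξ η => ?_⟩
  set S := ‖ξ‖ ^ p + ‖η‖ ^ p with hS
  rcases (by positivity : 0 ≤ S).eq_or_lt with hzero | hpos
  · have hξη : ξ = 0 ∧ η = 0 := by
      have := (add_eq_zero_iff_of_nonneg (by positivity) (by positivity)).1 (hS ▸ hzero.symm)
      simpa [Real.rpow_eq_zero, hp.ne'] using this
    simp [hξη, hp.ne', ← hzero]
  set c := S⁻¹ ^ p⁻¹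
  have hc : 0 < c := by positivity
  have hcp : c ^ p * S = 1 := by
    rw [Real.rpow_inv_rpow (by positivity) hp.ne', inv_mul_cancel₀ hpos.ne']
  have hscale : ∀ ζ : E, ‖c • ζ‖ ^ p = c ^ p * ‖ζ‖ ^ p := fun ζ => by
    rw [norm_smul, Real.norm_of_nonneg hc.le, Real.mul_rpow hc.le (norm_nonneg _)]
  have h := hC (c • ξ) (c • η) (by rw [hscale, hscale, ← mul_add, hcp])
  rw [← smul_sub, hscale, hhom c hc, hhom c hc, ← smul_sub, real_inner_smul_left,
    real_inner_smul_right, ← mul_assoc (c ^ (p - 1)), ← Real.rpow_add_one hc.ne',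
    sub_add_cancel] at h
  refine le_of_mul_le_mul_left ?_ (Real.rpow_pos_of_pos hc p)
  calc c ^ p * ‖ξ - η‖ ^ p
      ≤ C * (c ^ p * inner ℝ (T ξ - T η) (ξ - η)) + δ * (c ^ p * S) := by rwa [hcp, mul_one]
    _ = _ := by ring

end Homogeneous

section PLaplace

variable {N : ℕ} {p t : ℝ}

theorem mul_rpow_sub_two (hp : p ≠ 1) (ht : 0 ≤ t) : t * t ^ (p - 2) = t ^ (p - 1) := by
  rw [mul_comm, ← Real.rpow_add_one' ht (by contrapose! hp; linarith)]
  ring_nf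

theorem continuousOn_mul_rpow_sub_two (hp : 1 < p) :
    ContinuousOn (fun t : ℝ => t * t ^ (p - 2)) (Ici 0) :=
  (Real.continuous_rpow_const (sub_nonneg.2 hp.le)).continuousOn.congr fun _ ht =>
    mul_rpow_sub_two hp.ne' ht

theorem strictMonoOn_mul_rpow_sub_two (hp : 1 < p) :
    StrictMonoOn (fun t : ℝ => t * t ^ (p - 2)) (Ici 0) :=
  (Real.strictMonoOn_rpow_Ici_of_exponent_pos (sub_pos.2 hp)).congr fun _ ht =>
    (mul_rpow_sub_two hp.ne' ht).symm

theorem aMap_rpow_sub_two_smul {c : ℝ} (hc : 0 < c) (ξ : RN N) :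
    aMap N (· ^ (p - 2)) (c • ξ) = c ^ (p - 1) • aMap N (· ^ (p - 2)) ξ := by
  simp only [aMap, norm_smul, Real.norm_of_nonneg hc.le, Real.mul_rpow hc.le (norm_nonneg ξ),
    smul_smul]
  congr 1
  rw [show p - 1 = p - 2 + 1 by ring, Real.rpow_add_one hc.ne']
  ring

theorem aMap_eq_sub_add (a₀ : ℝ → ℝ) (c : ℝ) (ξ : RN N) :
    aMap N a₀ ξ = aMap N (fun t => a₀ t - c * t ^ (p - 2)) ξ + c • aMap N (· ^ (p - 2)) ξ := by
  simp only [aMap, smul_smul, ← add_smul, sub_add_cancel]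

end PLaplace

/-- The profiles `a₀` for which `ξ ↦ a₀(‖ξ‖) ξ` has `(p - 1)`-growth and exceeds some positive
multiple of the `p`-Laplacian `‖ξ‖ ^ (p - 2) ξ` by a monotone field, and `p G₀(t) - t² a₀(t)` is
bounded below. -/
structure IsPLaplaceLike (p : ℝ) (a₀ : ℝ → ℝ) : Prop where
  continuousOn : ContinuousOn (fun t => t * a₀ t) (Ici 0)
  exists_monotoneOn_sub : ∃ c > 0, MonotoneOn (fun t => t * a₀ t - c * t ^ (p - 1)) (Ici 0)
  exists_mul_le : ∃ B, ∀ t, 0 ≤ t → t * a₀ t ≤ B * (1 + t ^ (p - 1))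
  exists_le_primitive : ∃ C, ∀ t, 0 ≤ t → -C ≤ p * G₀ a₀ t - t ^ 2 * a₀ t

namespace IsPLaplaceLike

variable {N : ℕ} {p : ℝ} {a₀ : ℝ → ℝ}

theorem exists_le_mul (h : IsPLaplaceLike p a₀) (hp : 1 < p) :
    ∃ c > 0, ∀ t, 0 ≤ t → c * t ^ (p - 1) ≤ t * a₀ t := by
  obtain ⟨c, hc, hmono⟩ := h.exists_monotoneOn_sub
  refine ⟨c, hc, fun t ht => ?_⟩
  have := hmono (mem_Ici.2 le_rfl) ht ht
  simp only [Real.zero_rpow (sub_pos.2 hp).ne', zero_mul, mul_zero, sub_zero] at this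
  linarith

theorem exists_norm_aMap_le (h : IsPLaplaceLike p a₀) (hp : 1 < p) :
    ∃ B, ∀ ξ : RN N, ‖aMap N a₀ ξ‖ ≤ B * (1 + ‖ξ‖ ^ (p - 1)) := by
  obtain ⟨B, hB⟩ := h.exists_mul_le
  obtain ⟨c, hc, hle⟩ := h.exists_le_mul hp
  refine ⟨B, fun ξ => ?_⟩
  rw [norm_aMap, abs_of_nonneg ((by positivity : 0 ≤ c * ‖ξ‖ ^ (p - 1)).trans
    (hle _ (norm_nonneg ξ)))]
  exact hB _ (norm_nonneg ξ)

theorem exists_norm_rpow_le_inner (h : IsPLaplaceLike p a₀) (hp : 1 < p) :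
    ∃ c > 0, ∀ ξ : RN N, c * ‖ξ‖ ^ p ≤ inner ℝ (aMap N a₀ ξ) ξ := by
  obtain ⟨c, hc, hle⟩ := h.exists_le_mul hp
  refine ⟨c, hc, fun ξ => ?_⟩
  rw [inner_aMap_self]
  calc c * ‖ξ‖ ^ p = ‖ξ‖ * (c * ‖ξ‖ ^ (p - 1)) := by
        rw [mul_left_comm, mul_comm ‖ξ‖, ← Real.rpow_add_one' (norm_nonneg ξ) (by linarith),
          sub_add_cancel]
    _ ≤ _ := mul_le_mul_of_nonneg_left (hle _ (norm_nonneg ξ)) (norm_nonneg ξ)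

theorem exists_inner_le_mul_GFun (h : IsPLaplaceLike p a₀) :
    ∃ C, ∀ ξ : RN N, inner ℝ (aMap N a₀ ξ) ξ ≤ p * GFun N a₀ ξ + C := by
  obtain ⟨C, hC⟩ := h.exists_le_primitive
  refine ⟨C, fun ξ => ?_⟩
  have := hC _ (norm_nonneg ξ)
  rw [inner_aMap_self, GFun]
  linarith

theorem exists_norm_sub_rpow_le (h : IsPLaplaceLike p a₀) (hp : 1 < p) {δ : ℝ} (hδ : 0 < δ) :
    ∃ C, ∀ ξ η : RN N, ‖ξ - η‖ ^ p ≤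
      C * inner ℝ (aMap N a₀ ξ - aMap N a₀ η) (ξ - η) + δ * (‖ξ‖ ^ p + ‖η‖ ^ p) := by
  obtain ⟨c, hc, hmono⟩ := h.exists_monotoneOn_sub
  obtain ⟨C, hC, hle⟩ := exists_norm_sub_rpow_le_of_homogeneous (T := aMap N (· ^ (p - 2)))
    (zero_lt_one.trans hp) (continuous_aMap (continuousOn_mul_rpow_sub_two hp))
    (fun c hc ξ => aMap_rpow_sub_two_smul hc ξ)
    (fun ξ η => inner_aMap_sub_pos (strictMonoOn_mul_rpow_sub_two hp)) hδ
  refine ⟨C / c, fun ξ η => (hle ξ η).trans (add_le_add_left ?_ _)⟩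
  have hrest := inner_aMap_sub_nonneg (N := N) (b := fun t => a₀ t - c * t ^ (p - 2))
    (hmono.congr fun t ht => by rw [mul_sub, mul_left_comm, mul_rpow_sub_two hp.ne' ht]) ξ η
  rw [aMap_eq_sub_add (p := p) a₀ c ξ, aMap_eq_sub_add (p := p) a₀ c η, add_sub_add_comm,
    ← smul_sub, inner_add_left, real_inner_smul_left, mul_add, ← mul_assoc (C / c) c,
    div_mul_cancel₀ _ hc.ne']
  exact le_add_of_nonneg_left (mul_nonneg (by positivity) hrest)

end IsPLaplaceLike

namespace HypA

variable {N : ℕ} {p t : ℝ} {ϑ a₀ : ℝ → ℝ} {chat c₀ c₁ c₂ : ℝ}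

theorem differentiableAt (ha : HypA N p ϑ a₀) (ht : 0 < t) : DifferentiableAt ℝ a₀ t :=
  (ha.contDiffOn.differentiableOn (by simp)).differentiableAt (Ioi_mem_nhds ht)

theorem hasDerivAt_mul (ha : HypA N p ϑ a₀) (ht : 0 < t) :
    HasDerivAt (fun t => t * a₀ t) (deriv (fun t => t * a₀ t) t) t :=
  (differentiableAt_id.mul (ha.differentiableAt ht)).hasDerivAt

theorem fderiv_aMap_smul_unit (ha : HypA N p ϑ a₀) (ht : 0 < t) {e : RN N} (he : ‖e‖ = 1) :
    fderiv ℝ (aMap N a₀) (t • e) e = deriv (fun t => t * a₀ t) t • e := by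
  have hnorm : ∀ s : ℝ, 0 < s → ‖s • e‖ = s := fun s hs => by
    rw [norm_smul, he, mul_one, Real.norm_of_nonneg hs.le]
  have hne : t • e ≠ 0 := norm_pos_iff.1 ((hnorm t ht).symm ▸ ht)
  have hdiff : DifferentiableAt ℝ (aMap N a₀) (t • e) :=
    ((ha.differentiableAt (norm_pos_iff.2 hne)).comp _ (differentiableAt_id.norm ℝ hne)).smul
      differentiableAt_id
  have hline : HasDerivAt (fun s : ℝ => s • e) e t := by
    simpa using (hasDerivAt_id t).smul_const e
  refine (hdiff.hasFDerivAt.comp_hasDerivAt t hline).unique ?_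
  refine ((ha.hasDerivAt_mul ht).smul_const e).congr_of_eventuallyEq ?_
  filter_upwards [Ioi_mem_nhds ht] with s hs
  simp only [Function.comp_apply, aMap, hnorm s hs, smul_smul, mul_comm]

theorem le_deriv_mul (ha : HypA N p ϑ a₀) (hN : 1 ≤ N) (ht : 0 < t) :
    ϑ t / t ≤ deriv (fun t => t * a₀ t) t := by
  have he : ‖EuclideanSpace.single (⟨0, hN⟩ : Fin N) (1 : ℝ)‖ = 1 := by simp
  set e : RN N := EuclideanSpace.single ⟨0, hN⟩ 1
  have hnorm : ‖t • e‖ = t := by rw [norm_smul, he, mul_one, Real.norm_of_nonneg ht.le]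
  have h := ha.lower (t • e) (norm_pos_iff.1 (hnorm.symm ▸ ht)) e
  rw [ha.fderiv_aMap_smul_unit ht he, hnorm, real_inner_smul_left, real_inner_self_eq_norm_sq,
    he] at h
  simpa using h

theorem exists_deriv_mul_le (ha : HypA N p ϑ a₀) (hN : 1 ≤ N) :
    ∃ c₃ > 0, ∀ t > 0, deriv (fun t => t * a₀ t) t ≤ c₃ * (ϑ t / t) := by
  obtain ⟨c₃, hc₃, hupper⟩ := ha.upper
  refine ⟨c₃, hc₃, fun t ht => ?_⟩
  have he : ‖EuclideanSpace.single (⟨0, hN⟩ : Fin N) (1 : ℝ)‖ = 1 := by simp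
  set e : RN N := EuclideanSpace.single ⟨0, hN⟩ 1
  have hnorm : ‖t • e‖ = t := by rw [norm_smul, he, mul_one, Real.norm_of_nonneg ht.le]
  calc deriv (fun t => t * a₀ t) t ≤ ‖fderiv ℝ (aMap N a₀) (t • e) e‖ := by
        rw [ha.fderiv_aMap_smul_unit ht he, norm_smul, he, mul_one]
        exact le_abs_self _
    _ ≤ ‖fderiv ℝ (aMap N a₀) (t • e)‖ := by
        simpa [he] using (fderiv ℝ (aMap N a₀) (t • e)).le_opNorm e
    _ ≤ c₃ * (ϑ t / t) := by
        simpa [hnorm] using hupper (t • e) (norm_pos_iff.1 (hnorm.symm ▸ ht))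

theorem continuousOn_mul (ha : HypA N p ϑ a₀) : ContinuousOn (fun t => t * a₀ t) (Ici 0) := by
  intro t ht
  rcases eq_or_lt_of_le (mem_Ici.1 ht) with rfl | hpos
  · rw [← continuousWithinAt_Ioi_iff_Ici, ContinuousWithinAt, zero_mul]
    exact ha.tendsto_zero
  · exact (ha.hasDerivAt_mul hpos).continuousAt.continuousWithinAt

theorem hasDerivAt_mul_sub_rpow (ha : HypA N p ϑ a₀) (hp : 1 < p) (c : ℝ) (ht : 0 < t) :
    HasDerivAt (fun t => t * a₀ t - c / (p - 1) * t ^ (p - 1))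
      (deriv (fun t => t * a₀ t) t - c * t ^ (p - 2)) t := by
  have hpow := (Real.hasDerivAt_rpow_const (p := p - 1) (Or.inl ht.ne')).const_mul (c / (p - 1))
  refine ((ha.hasDerivAt_mul ht).sub hpow).congr_deriv ?_
  rw [← mul_assoc, div_mul_cancel₀ _ (sub_pos.2 hp).ne', show p - 1 - 1 = p - 2 by ring]

theorem monotoneOn_sub (ha : HypA N p ϑ a₀) (hN : 1 ≤ N) (hp : 1 < p)
    (hϑ : IsComparison p ϑ chat c₀ c₁ c₂) :
    MonotoneOn (fun t => t * a₀ t - c₁ / (p - 1) * t ^ (p - 1)) (Ici 0) := by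
  have hcont : ContinuousOn (fun t : ℝ => c₁ / (p - 1) * t ^ (p - 1)) (Ici 0) :=
    ((Real.continuous_rpow_const (sub_nonneg.2 hp.le)).const_mul _).continuousOn
  refine monotoneOn_of_deriv_nonneg (convex_Ici 0) (ha.continuousOn_mul.sub hcont) ?_ ?_ <;>
    rw [interior_Ici]
  · exact fun t ht =>
      (ha.hasDerivAt_mul_sub_rpow hp c₁ ht).differentiableAt.differentiableWithinAt
  intro t ht
  rw [(ha.hasDerivAt_mul_sub_rpow hp c₁ ht).deriv, sub_nonneg]
  refine le_trans ?_ (ha.le_deriv_mul hN ht)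
  rw [le_div_iff₀ ht, mul_assoc, mul_comm _ t, mul_rpow_sub_two hp.ne' (le_of_lt ht)]
  exact (hϑ.growth t ht).1

theorem exists_antitoneOn_sub (ha : HypA N p ϑ a₀) (hN : 1 ≤ N) (hp : 1 < p)
    (hϑ : IsComparison p ϑ chat c₀ c₁ c₂) :
    ∃ K > 0, AntitoneOn (fun t => t * a₀ t - K * t ^ (p - 1)) (Ici 1) := by
  obtain ⟨c₃, hc₃, hle⟩ := ha.exists_deriv_mul_le hN
  have hc₂ := hϑ.c₂_pos
  have hp1 : 0 < p - 1 := sub_pos.2 hp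
  have hderiv := fun t ht => ha.hasDerivAt_mul_sub_rpow (t := t) hp (c₃ * (2 * c₂)) ht
  refine ⟨c₃ * (2 * c₂) / (p - 1), by positivity, ?_⟩
  refine antitoneOn_of_deriv_nonpos (convex_Ici 1)
    (fun t ht => (hderiv t (one_pos.trans_le ht)).continuousAt.continuousWithinAt) ?_ ?_ <;>
    rw [interior_Ici]
  · exact fun t ht => (hderiv t (one_pos.trans ht)).differentiableAt.differentiableWithinAt
  intro t ht
  have ht0 : 0 < t := one_pos.trans ht
  have hone : 1 ≤ t ^ (p - 1) := Real.one_le_rpow (le_of_lt ht) hp1.le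
  rw [(hderiv t ht0).deriv, sub_nonpos]
  refine (hle t ht0).trans ?_
  rw [mul_assoc c₃]
  refine mul_le_mul_of_nonneg_left ?_ hc₃.le
  rw [div_le_iff₀ ht0, mul_assoc, mul_comm _ t, mul_rpow_sub_two hp.ne' ht0.le]
  calc ϑ t ≤ c₂ * (1 + t ^ (p - 1)) := (hϑ.growth t ht0).2
    _ ≤ c₂ * (t ^ (p - 1) + t ^ (p - 1)) := by gcongr
    _ = 2 * c₂ * t ^ (p - 1) := by ring

theorem exists_mul_le (ha : HypA N p ϑ a₀) (hN : 1 ≤ N) (hp : 1 < p)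
    (hϑ : IsComparison p ϑ chat c₀ c₁ c₂) :
    ∃ B, ∀ t, 0 ≤ t → t * a₀ t ≤ B * (1 + t ^ (p - 1)) := by
  obtain ⟨K, hK, hanti⟩ := ha.exists_antitoneOn_sub hN hp hϑ
  have ha1 := ha.pos 1 one_pos
  refine ⟨a₀ 1 + K, fun t ht => ?_⟩
  have hpow : 0 ≤ t ^ (p - 1) := Real.rpow_nonneg ht _
  suffices t * a₀ t ≤ a₀ 1 + K * t ^ (p - 1) by nlinarith [mul_nonneg ha1.le hpow]
  rcases ht.eq_or_lt with rfl | hpos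
  · rw [zero_mul]
    positivity
  rcases le_total t 1 with h | h
  · have := ha.strictMono.monotoneOn hpos (mem_Ioi.2 one_pos) h
    simp only [one_mul] at this
    exact this.trans (le_add_of_nonneg_right (by positivity))
  · have := hanti (mem_Ici.2 le_rfl) h h
    simp only [one_mul, Real.one_rpow, mul_one] at this
    linarith

theorem isPLaplaceLike (ha : HypA N p ϑ a₀) (hN : 1 ≤ N) (hp : 1 < p)
    (hϑ : IsComparison p ϑ chat c₀ c₁ c₂) : IsPLaplaceLike p a₀ where
  continuousOn := ha.continuousOn_mul
  exists_monotoneOn_sub :=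
    ⟨c₁ / (p - 1), div_pos hϑ.c₁_pos (sub_pos.2 hp), ha.monotoneOn_sub hN hp hϑ⟩
  exists_mul_le := ha.exists_mul_le hN hp hϑ
  exists_le_primitive := by
    obtain ⟨c₆, hc₆, hle⟩ := ha.primitive_lower
    refine ⟨c₆, fun t ht => ?_⟩
    rcases ht.eq_or_lt with rfl | hpos
    · simpa [G₀] using hc₆.le
    · exact hle t hpos

end HypA

section TestFunction

variable {N : ℕ} {Ω : Set (RN N)} {ψ : RN N → ℝ}

theorem norm_gradient (ψ : RN N → ℝ) (x : RN N) : ‖gradient ψ x‖ = ‖fderiv ℝ ψ x‖ :=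
  LinearIsometryEquiv.norm_map _ _

theorem IsTestFunction.support_subset (hψ : IsTestFunction Ω ψ) : Function.support ψ ⊆ Ω :=
  (subset_tsupport ψ).trans hψ.tsupport_subset

theorem IsTestFunction.continuous_gradient (hψ : IsTestFunction Ω ψ) : Continuous (gradient ψ) :=
  (LinearIsometryEquiv.continuous _).comp (hψ.contDiff.continuous_fderiv (by simp))

theorem IsTestFunction.eLpNorm_fderiv (hψ : IsTestFunction Ω ψ) (s : ℝ≥0∞) :
    eLpNorm (fderiv ℝ ψ) s volume = eLpNorm (gradient ψ) s (volume.restrict Ω) := by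
  rw [eLpNorm_restrict_eq_of_support_subset]
  · exact eLpNorm_congr_norm_ae (ae_of_all _ fun x => (norm_gradient ψ x).symm)
  · intro x hx
    rw [Function.mem_support, ← norm_pos_iff, norm_gradient, norm_pos_iff] at hx
    exact hψ.tsupport_subset (support_fderiv_subset ℝ hx)

end TestFunction

theorem exists_eLpNorm_le_mul_eLpNorm {X E : Type*} [MeasurableSpace X] [NormedAddCommGroup E]
    (μ : Measure X) [IsFiniteMeasure μ] {p q : ℝ≥0∞} (hp : p ≠ 0) (hpq : p ≤ q) :
    ∃ C : ℝ≥0, ∀ f : X → E, AEStronglyMeasurable f μ → eLpNorm f p μ ≤ C * eLpNorm f q μ := by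
  have hexp : 0 ≤ 1 / p.toReal - 1 / q.toReal := by
    rcases eq_or_ne q ⊤ with rfl | hq
    · simp
    · exact sub_nonneg.2 (one_div_le_one_div_of_le
        (ENNReal.toReal_pos hp (hpq.trans_lt hq.lt_top).ne) (ENNReal.toReal_mono hq hpq))
  refine ⟨(μ univ ^ (1 / p.toReal - 1 / q.toReal)).toNNReal, fun f hf => ?_⟩
  rw [ENNReal.coe_toNNReal (ENNReal.rpow_ne_top_of_nonneg hexp (measure_ne_top μ _)), mul_comm]
  exact eLpNorm_le_eLpNorm_mul_rpow_measure_univ hpq hf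

theorem enorm_le_lintegral_fderiv_of_finrank_eq_one {E : Type*} [NormedAddCommGroup E]
    [InnerProductSpace ℝ E] [FiniteDimensional ℝ E] [MeasurableSpace E] [BorelSpace E]
    (hE : Module.finrank ℝ E = 1) {ψ : E → ℝ} (hψ : ContDiff ℝ 1 ψ) (hc : HasCompactSupport ψ)
    (x : E) :
    ‖ψ x‖ₑ ≤ ∫⁻ y, ‖fderiv ℝ ψ y‖ₑ := by
  let L : ℝ ≃ₗᵢ[ℝ] E := (stdOrthonormalBasis ℝ ℝ).equiv (stdOrthonormalBasis ℝ E)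
    (finCongr (by rw [hE, Module.finrank_self]))
  have hderiv : ∀ t, ‖deriv (ψ ∘ L) t‖ₑ ≤ ‖fderiv ℝ ψ (L t)‖ₑ := by
    intro t
    have hL : HasDerivAt (fun t => L t) (L 1) t := by
      simpa using (L.toContinuousLinearEquiv.hasFDerivAt (x := t)).hasDerivAt
    rw [((hψ.differentiable (by simp) (L t)).hasFDerivAt.comp_hasDerivAt t hL).deriv,
      enorm_le_iff_norm_le]
    simpa using (fderiv ℝ ψ (L t)).le_opNorm (L 1)
  have hline := (hc.comp_homeomorph L.toHomeomorph).enorm_le_lintegral_Ici_deriv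
    (hψ.comp L.toContinuousLinearEquiv.contDiff) (L.symm x)
  calc ‖ψ x‖ₑ ≤ ∫⁻ t in Iic (L.symm x), ‖deriv (ψ ∘ L) t‖ₑ := by simpa using hline
    _ ≤ ∫⁻ t, ‖deriv (ψ ∘ L) t‖ₑ := setLIntegral_le_lintegral _ _
    _ ≤ ∫⁻ t, ‖fderiv ℝ ψ (L t)‖ₑ := lintegral_mono hderiv
    _ = ∫⁻ y, ‖fderiv ℝ ψ y‖ₑ := L.measurePreserving.lintegral_comp_emb
        L.toHomeomorph.measurableEmbedding fun y => ‖fderiv ℝ ψ y‖ₑ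

section CriticalExponent

variable {N : ℕ} {p q r τ : ℝ}

theorem le_critExp_self (hp : 0 < p) : (p : EReal) ≤ critExp N p := by
  unfold critExp
  split_ifs with hpN
  · rw [EReal.coe_le_coe_iff, le_div_iff₀ (sub_pos.2 hpN)]
    nlinarith
  · exact le_top

theorem inv_sub_inv_le_inv_of_le_critExp (hp : 0 < p) (hpN : p < N) (hq : 0 < q)
    (hqc : (q : EReal) ≤ critExp N p) : p⁻¹ - (N : ℝ)⁻¹ ≤ q⁻¹ := by
  rw [critExp, if_pos hpN, EReal.coe_le_coe_iff] at hqc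
  have hN : (0 : ℝ) < N := hp.trans hpN
  have hcrit : p⁻¹ - (N : ℝ)⁻¹ = (N * p / (N - p))⁻¹ := by
    field_simp
  rw [hcrit]
  exact inv_anti₀ hq hqc

theorem exists_interpolation_exponent (hp : 0 < p) (hpr : p < r) (hr : (r : EReal) < critExp N p)
    (hτ : (r - p) * max (N / p) 1 < τ) :
    ∃ q, r < q ∧ (q : EReal) ≤ critExp N p ∧ q * (r - p) < τ * (q - p) := by
  have hrp : 0 < r - p := sub_pos.2 hpr
  have hmax : ∀ c ≤ max (N / p) 1, (r - p) * c < τ := fun c hc =>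
    (mul_le_mul_of_nonneg_left hc hrp.le).trans_lt hτ
  have hNp := hmax (N / p) (le_max_left _ _)
  have hone := hmax 1 (le_max_right _ _)
  unfold critExp at hr ⊢
  split_ifs at hr ⊢ with hpN
  · have hsub : (0 : ℝ) < N - p := sub_pos.2 hpN
    have hpos : 0 < p ^ 2 / (N - p) := by positivity
    refine ⟨N * p / (N - p), EReal.coe_lt_coe_iff.1 hr, le_rfl, ?_⟩
    calc N * p / (N - p) * (r - p) = (r - p) * (N / p) * (p ^ 2 / (N - p)) := by field_simp
      _ < τ * (p ^ 2 / (N - p)) := mul_lt_mul_of_pos_right hNp hpos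
      _ = τ * (N * p / (N - p) - p) := by
        field_simp
        ring
  · have hgap : 0 < τ - (r - p) := by linarith
    refine ⟨max (r + 1) ((τ * p + 1) / (τ - (r - p))), ?_, le_top, ?_⟩
    · exact (lt_add_one r).trans_le (le_max_left _ _)
    · have := le_max_right (r + 1) ((τ * p + 1) / (τ - (r - p)))
      rw [div_le_iff₀ hgap] at this
      linarith

theorem exists_gt_le_critExp (hr : (r : EReal) < critExp N p) :
    ∃ q, r < q ∧ (q : EReal) ≤ critExp N p := by
  obtain ⟨q, hrq, hq⟩ := EReal.lt_iff_exists_real_btwn.1 hr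
  exact ⟨q, EReal.coe_lt_coe_iff.1 hrq, hq.le⟩

end CriticalExponent

section SobolevInequality

variable {N : ℕ} {Ω : Set (RN N)} {p q : ℝ}

theorem exists_eLpNorm_le_gradient_of_inv_sub_inv_le (hb : Bornology.IsBounded Ω) (hp : 1 ≤ p)
    (hpN : p < N) (hq : 0 < q) (hpq : p⁻¹ - (N : ℝ)⁻¹ ≤ q⁻¹) :
    ∃ C : ℝ≥0, ∀ ψ : RN N → ℝ, IsTestFunction Ω ψ →
      eLpNorm ψ (ENNReal.ofReal q) (volume.restrict Ω) ≤
        C * eLpNorm (gradient ψ) (ENNReal.ofReal p) (volume.restrict Ω) := by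
  have hp0 : 0 ≤ p := zero_le_one.trans hp
  refine ⟨eLpNormLESNormFDerivOfLeConst ℝ (volume : Measure (RN N)) Ω p.toNNReal q.toNNReal,
    fun ψ hψ => ?_⟩
  rw [← hψ.eLpNorm_fderiv, eLpNorm_restrict_eq_of_support_subset hψ.support_subset]
  refine eLpNorm_le_eLpNorm_fderiv_of_le volume (hψ.contDiff.of_le (by simp))
    hψ.support_subset (by simpa using hp) ?_ ?_ hb
  · rw [finrank_euclideanSpace_fin, ← NNReal.coe_lt_coe, Real.coe_toNNReal _ hp0]
    simpa using hpN
  · rwa [finrank_euclideanSpace_fin, NNReal.coe_inv, Real.coe_toNNReal _ hp0,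
      Real.coe_toNNReal _ hq.le]

theorem exists_eLpNorm_gradient_le_of_le (hb : Bornology.IsBounded Ω) {p₀ : ℝ} (hp₀ : 0 < p₀)
    (hle : p₀ ≤ p) : ∃ C : ℝ≥0, ∀ ψ : RN N → ℝ, IsTestFunction Ω ψ →
      eLpNorm (gradient ψ) (ENNReal.ofReal p₀) (volume.restrict Ω) ≤
        C * eLpNorm (gradient ψ) (ENNReal.ofReal p) (volume.restrict Ω) := by
  have : Fact (volume Ω < ⊤) := ⟨hb.measure_lt_top⟩
  obtain ⟨C, hC⟩ := exists_eLpNorm_le_mul_eLpNorm (E := RN N) (volume.restrict Ω)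
    (ENNReal.ofReal_pos.2 hp₀).ne' (ENNReal.ofReal_le_ofReal hle)
  exact ⟨C, fun ψ hψ => hC _ hψ.continuous_gradient.aestronglyMeasurable⟩

/- For `p ≥ N` one applies the subcritical inequality with an exponent `p₀ < N` whose critical
exponent is at least `q`. -/
theorem exists_eLpNorm_le_gradient_of_two_le (hb : Bornology.IsBounded Ω) (hN : 2 ≤ N)
    (hpN : N ≤ p) (hq : 0 < q) :
    ∃ C : ℝ≥0, ∀ ψ : RN N → ℝ, IsTestFunction Ω ψ →
      eLpNorm ψ (ENNReal.ofReal q) (volume.restrict Ω) ≤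
        C * eLpNorm (gradient ψ) (ENNReal.ofReal p) (volume.restrict Ω) := by
  have hN2 : (2 : ℝ) ≤ N := by exact_mod_cast hN
  set q₁ := max q 2
  have hq₁ : 2 ≤ q₁ := le_max_right _ _
  set p₀ : ℝ := N * q₁ / (N + q₁) with hp₀
  have hp₀_one : 1 ≤ p₀ := by
    rw [hp₀, le_div_iff₀ (by positivity)]
    nlinarith
  have hp₀N : p₀ < N := by
    rw [hp₀, div_lt_iff₀ (by positivity)]
    nlinarith
  have hcrit : p₀⁻¹ - (N : ℝ)⁻¹ = q₁⁻¹ := by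
    rw [hp₀]
    field_simp
    ring
  obtain ⟨C, hC⟩ := exists_eLpNorm_le_gradient_of_inv_sub_inv_le hb hp₀_one hp₀N hq
    (hcrit.trans_le (inv_anti₀ hq (le_max_left _ _)))
  obtain ⟨D, hD⟩ := exists_eLpNorm_gradient_le_of_le hb (zero_lt_one.trans_le hp₀_one)
    (hp₀N.le.trans hpN)
  refine ⟨C * D, fun ψ hψ => (hC ψ hψ).trans ?_⟩
  rw [ENNReal.coe_mul, mul_assoc]
  gcongr
  exact hD ψ hψ

theorem exists_eLpNorm_le_gradient_of_one {Ω : Set (RN 1)} (hb : Bornology.IsBounded Ω)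
    (hp : 1 ≤ p) (hq : 0 < q) :
    ∃ C : ℝ≥0, ∀ ψ : RN 1 → ℝ, IsTestFunction Ω ψ →
      eLpNorm ψ (ENNReal.ofReal q) (volume.restrict Ω) ≤
        C * eLpNorm (gradient ψ) (ENNReal.ofReal p) (volume.restrict Ω) := by
  have : Fact (volume Ω < ⊤) := ⟨hb.measure_lt_top⟩
  obtain ⟨C, hC⟩ := exists_eLpNorm_le_mul_eLpNorm (E := ℝ) (volume.restrict Ω)
    (ENNReal.ofReal_pos.2 hq).ne' (le_top : ENNReal.ofReal q ≤ ⊤)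
  obtain ⟨D, hD⟩ := exists_eLpNorm_gradient_le_of_le hb one_pos hp
  refine ⟨C * D, fun ψ hψ => ?_⟩
  have hsup : eLpNorm ψ ⊤ (volume.restrict Ω) ≤
      eLpNorm (gradient ψ) (ENNReal.ofReal 1) (volume.restrict Ω) := by
    refine eLpNormEssSup_le_of_ae_enorm_bound (ae_of_all _ fun x => ?_)
    rw [← hψ.eLpNorm_fderiv, ENNReal.ofReal_one, eLpNorm_one_eq_lintegral_enorm]
    exact enorm_le_lintegral_fderiv_of_finrank_eq_one (by simp) (hψ.contDiff.of_le (by simp))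
      hψ.hasCompactSupport x
  refine (hC ψ hψ.contDiff.continuous.aestronglyMeasurable).trans ?_
  rw [ENNReal.coe_mul, mul_assoc]
  gcongr
  exact hsup.trans (hD ψ hψ)

theorem exists_eLpNorm_le_gradient (hN : 1 ≤ N) (hb : Bornology.IsBounded Ω) (hp : 1 ≤ p)
    (hq : 0 < q) (hqc : (q : EReal) ≤ critExp N p) :
    ∃ C : ℝ≥0, ∀ ψ : RN N → ℝ, IsTestFunction Ω ψ →
      eLpNorm ψ (ENNReal.ofReal q) (volume.restrict Ω) ≤
        C * eLpNorm (gradient ψ) (ENNReal.ofReal p) (volume.restrict Ω) := by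
  rcases lt_or_ge p N with hpN | hpN
  · exact exists_eLpNorm_le_gradient_of_inv_sub_inv_le hb hp hpN hq
      (inv_sub_inv_le_inv_of_le_critExp (zero_lt_one.trans_le hp) hpN hq hqc)
  rcases hN.eq_or_lt with rfl | hN2
  · exact exists_eLpNorm_le_gradient_of_one hb hp hq
  · exact exists_eLpNorm_le_gradient_of_two_le hb hN2 hpN hq

end SobolevInequality

namespace W1p0

variable {N : ℕ} {Ω : Set (RN N)} {p q : ℝ} [Fact (1 < p)]

/-- The weak gradient as a bounded operator `W^{1,p}_0(Ω) → L^p(Ω; ℝ^N)`. -/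
def gradL (Ω : Set (RN N)) (p : ℝ) [Fact (1 < p)] :
    W1p0 Ω p →L[ℝ] Lp (RN N) (ENNReal.ofReal p) (volume.restrict Ω) :=
  (WithLp.sndL (ENNReal.ofReal p) ℝ _ _).comp (testPairs Ω p).topologicalClosure.subtypeL

/-- The inclusion `W^{1,p}_0(Ω) → L^p(Ω)` as a bounded operator. -/
def fnL (Ω : Set (RN N)) (p : ℝ) [Fact (1 < p)] :
    W1p0 Ω p →L[ℝ] Lp ℝ (ENNReal.ofReal p) (volume.restrict Ω) :=
  (WithLp.fstL (ENNReal.ofReal p) ℝ _ _).comp (testPairs Ω p).topologicalClosure.subtypeL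

theorem coe_gradL (u : W1p0 Ω p) : (gradL Ω p u : RN N → RN N) = u.grad := rfl

theorem coe_fnL (u : W1p0 Ω p) : (fnL Ω p u : RN N → ℝ) = u.fn := rfl

theorem fn_add (u v : W1p0 Ω p) :
    (u + v).fn =ᵐ[volume.restrict Ω] u.fn + v.fn := by
  rw [← coe_fnL, map_add]
  exact Lp.coeFn_add _ _

theorem fn_smul (c : ℝ) (u : W1p0 Ω p) : (c • u).fn =ᵐ[volume.restrict Ω] c • u.fn := by
  rw [← coe_fnL, map_smul]
  exact Lp.coeFn_smul _ _

theorem norm_gradL_le (u : W1p0 Ω p) : ‖gradL Ω p u‖ ≤ ‖u‖ :=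
  WithLp.norm_snd_le _ (u : LpPair Ω p)

theorem norm_le_add (u : W1p0 Ω p) : ‖u‖ ≤ ‖fnL Ω p u‖ + ‖gradL Ω p u‖ := by
  have hp : 1 < p := Fact.out
  have hnorm : ‖u‖ = (‖fnL Ω p u‖ ^ p + ‖gradL Ω p u‖ ^ p) ^ (1 / p) := by
    have htoReal : (ENNReal.ofReal p).toReal = p := ENNReal.toReal_ofReal (by linarith)
    have := WithLp.prod_norm_eq_add (p := ENNReal.ofReal p) (by rw [htoReal]; linarith)
      (u : LpPair Ω p)
    rwa [htoReal] at this
  rw [hnorm]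
  exact Real.rpow_add_rpow_le_add (norm_nonneg _) (norm_nonneg _) hp.le

theorem exists_tendsto_testFunction (u : W1p0 Ω p) :
    ∃ (w : ℕ → W1p0 Ω p) (ψ : ℕ → RN N → ℝ), Tendsto w atTop (𝓝 u) ∧
      ∀ n, IsTestFunction Ω (ψ n) ∧ (w n).fn =ᵐ[volume.restrict Ω] ψ n ∧
        (w n).grad =ᵐ[volume.restrict Ω] gradient (ψ n) := by
  obtain ⟨w, hw, hlim⟩ := mem_closure_iff_seq_limit.1 u.2
  choose ψ hψ using id hw
  exact ⟨fun n => ⟨w n, subset_closure (hw n)⟩, ψ, tendsto_subtype_rng.2 hlim,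
    fun n => ⟨(hψ n).1, (hψ n).2.1, (hψ n).2.2⟩⟩

theorem exists_eLpNorm_fn_le (hN : 1 ≤ N) (hb : Bornology.IsBounded Ω) (hq : 0 < q)
    (hqc : (q : EReal) ≤ critExp N p) : ∃ C : ℝ≥0, ∀ u : W1p0 Ω p,
      eLpNorm u.fn (ENNReal.ofReal q) (volume.restrict Ω) ≤ C * ‖gradL Ω p u‖ₑ := by
  obtain ⟨C, hC⟩ := exists_eLpNorm_le_gradient hN hb (Fact.out : 1 < p).le hq hqc
  refine ⟨C, fun u => ?_⟩
  obtain ⟨w, ψ, hw, hψ⟩ := u.exists_tendsto_testFunction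
  have hfn : Tendsto (fun n => fnL Ω p (w n)) atTop (𝓝 (fnL Ω p u)) :=
    ((fnL Ω p).continuous.tendsto u).comp hw
  have hgrad : Tendsto (fun n => (C : ℝ≥0∞) * ‖gradL Ω p (w n)‖ₑ) atTop
      (𝓝 (C * ‖gradL Ω p u‖ₑ)) :=
    ENNReal.Tendsto.const_mul ((continuous_enorm.tendsto _).comp
      (((gradL Ω p).continuous.tendsto u).comp hw)) (Or.inr ENNReal.coe_ne_top)
  obtain ⟨k, hk, hae⟩ := (tendstoInMeasure_of_tendsto_Lp hfn).exists_seq_tendsto_ae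
  refine (Lp.eLpNorm_lim_le_liminf_eLpNorm (fun n => Lp.aestronglyMeasurable _) _ hae).trans ?_
  rw [← (hgrad.comp hk.tendsto_atTop).liminf_eq]
  refine liminf_le_liminf (Eventually.of_forall fun n => ?_)
  rw [Function.comp_apply, coe_fnL, eLpNorm_congr_ae (hψ (k n)).2.1, Lp.enorm_def,
    coe_gradL, eLpNorm_congr_ae (hψ (k n)).2.2]
  exact hC _ (hψ (k n)).1

theorem exists_embedding_of_eLpNorm_le {s : ℝ≥0∞} [Fact (1 ≤ s)] {C : ℝ≥0}
    (hC : ∀ u : W1p0 Ω p, eLpNorm u.fn s (volume.restrict Ω) ≤ C * ‖gradL Ω p u‖ₑ) :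
    ∃ J : W1p0 Ω p →L[ℝ] Lp ℝ s (volume.restrict Ω),
      (∀ u, J u =ᵐ[volume.restrict Ω] u.fn) ∧ ∀ u, ‖J u‖ ≤ C * ‖gradL Ω p u‖ := by
  have hmem : ∀ u : W1p0 Ω p, MemLp u.fn s (volume.restrict Ω) := fun u =>
    ⟨Lp.aestronglyMeasurable (fnL Ω p u),
      (hC u).trans_lt (ENNReal.mul_lt_top ENNReal.coe_lt_top enorm_lt_top)⟩
  have hbound : ∀ u : W1p0 Ω p, ‖(hmem u).toLp‖ ≤ C * ‖gradL Ω p u‖ := fun u => by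
    rw [Lp.norm_toLp]
    refine ENNReal.toReal_le_of_le_ofReal (by positivity) ((hC u).trans_eq ?_)
    rw [ENNReal.ofReal_mul (NNReal.coe_nonneg C), ofReal_norm, ENNReal.ofReal_coe_nnreal]
  let J : W1p0 Ω p →ₗ[ℝ] Lp ℝ s (volume.restrict Ω) :=
    { toFun := fun u => (hmem u).toLp
      map_add' := fun u v => by
        rw [← MemLp.toLp_add]
        exact MemLp.toLp_congr _ _ (fn_add u v)
      map_smul' := fun c u => by
        rw [RingHom.id_apply, ← MemLp.toLp_const_smul]
        exact MemLp.toLp_congr _ _ (fn_smul c u) }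
  exact ⟨J.mkContinuous C fun u =>
      (hbound u).trans (mul_le_mul_of_nonneg_left u.norm_gradL_le C.2),
    fun u => (hmem u).coeFn_toLp, hbound⟩

theorem exists_sobolev_embedding (hN : 1 ≤ N) (hb : Bornology.IsBounded Ω)
    [hq : Fact (1 ≤ ENNReal.ofReal q)] (hqc : (q : EReal) ≤ critExp N p) :
    ∃ (J : W1p0 Ω p →L[ℝ] Lp ℝ (ENNReal.ofReal q) (volume.restrict Ω)) (C : ℝ≥0),
      (∀ u, J u =ᵐ[volume.restrict Ω] u.fn) ∧ ∀ u, ‖J u‖ ≤ C * ‖gradL Ω p u‖ := by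
  obtain ⟨C, hC⟩ := exists_eLpNorm_fn_le (Ω := Ω) hN hb
    (zero_lt_one.trans_le (ENNReal.one_le_ofReal.1 hq.out)) hqc
  obtain ⟨J, hJ⟩ := exists_embedding_of_eLpNorm_le hC
  exact ⟨J, C, hJ⟩

theorem exists_norm_le_norm_gradL (hN : 1 ≤ N) (hb : Bornology.IsBounded Ω) :
    ∃ C : ℝ≥0, ∀ u : W1p0 Ω p, ‖u‖ ≤ C * ‖gradL Ω p u‖ := by
  have hp : 1 < p := Fact.out
  obtain ⟨J, C, hJ, hle⟩ := exists_sobolev_embedding (Ω := Ω) hN hb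
    (le_critExp_self (N := N) (zero_lt_one.trans hp))
  refine ⟨C + 1, fun u => u.norm_le_add.trans ?_⟩
  have hfn : fnL Ω p u = J u := Lp.ext (hJ u).symm
  rw [hfn, NNReal.coe_add, NNReal.coe_one, add_mul, one_mul]
  exact add_le_add_left (hle u) _

end W1p0

section Translation

variable {E F : Type*} [NormedAddCommGroup E] [NormedSpace ℝ E] [NormedAddCommGroup F]
  [NormedSpace ℝ F] [CompleteSpace F] {ψ : E → F}

theorem enorm_add_sub_le_lintegral_fderiv (hψ : ContDiff ℝ 1 ψ) (x z : E) :
    ‖ψ (x + z) - ψ x‖ₑ ≤ ∫⁻ t in Ioc (0 : ℝ) 1, ‖z‖ₑ * ‖fderiv ℝ ψ (x + t • z)‖ₑ := by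
  have : Continuous (fderiv ℝ ψ) := hψ.continuous_fderiv (by simp)
  have hderiv : ∀ t : ℝ, HasDerivAt (fun t : ℝ => ψ (x + t • z)) (fderiv ℝ ψ (x + t • z) z) t := by
    intro t
    have hline : HasDerivAt (fun t : ℝ => x + t • z) z t := by
      simpa using ((hasDerivAt_id t).smul_const z).const_add x
    exact (hψ.differentiable (by simp) (x + t • z)).hasFDerivAt.comp_hasDerivAt t hline
  have hcont : Continuous fun t : ℝ => fderiv ℝ ψ (x + t • z) z := by fun_prop
  have hftc := intervalIntegral.integral_eq_sub_of_hasDerivAt (a := 0) (b := 1)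
    (fun t _ => hderiv t) (hcont.intervalIntegrable _ _)
  simp only [one_smul, zero_smul, add_zero] at hftc
  rw [← hftc, intervalIntegral.integral_of_le zero_le_one]
  refine (enorm_integral_le_lintegral_enorm _).trans (lintegral_mono fun t => ?_)
  rw [mul_comm]
  exact ContinuousLinearMap.le_opENorm _ _

variable [FiniteDimensional ℝ E] [MeasurableSpace E] [BorelSpace E] {μ : Measure E}
  [μ.IsAddHaarMeasure]

theorem lintegral_enorm_add_sub_le (hψ : ContDiff ℝ 1 ψ) (z : E) :
    ∫⁻ x, ‖ψ (x + z) - ψ x‖ₑ ∂μ ≤ ‖z‖ₑ * ∫⁻ x, ‖fderiv ℝ ψ x‖ₑ ∂μ := by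
  have : Continuous (fderiv ℝ ψ) := hψ.continuous_fderiv (by simp)
  have hmeas : Measurable fun y : E × ℝ => ‖z‖ₑ * ‖fderiv ℝ ψ (y.1 + y.2 • z)‖ₑ :=
    (Continuous.measurable (by fun_prop)).const_mul _
  have htranslate : ∀ t : ℝ, ∫⁻ x, ‖z‖ₑ * ‖fderiv ℝ ψ (x + t • z)‖ₑ ∂μ =
      ‖z‖ₑ * ∫⁻ x, ‖fderiv ℝ ψ x‖ₑ ∂μ := by
    intro t
    rw [lintegral_const_mul _ (Continuous.measurable (by fun_prop)),
      lintegral_add_right_eq_self (fun x => ‖fderiv ℝ ψ x‖ₑ)]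
  calc ∫⁻ x, ‖ψ (x + z) - ψ x‖ₑ ∂μ
      ≤ ∫⁻ x, (∫⁻ t in Ioc (0 : ℝ) 1, ‖z‖ₑ * ‖fderiv ℝ ψ (x + t • z)‖ₑ) ∂μ :=
        lintegral_mono fun x => enorm_add_sub_le_lintegral_fderiv hψ x z
    _ = ∫⁻ t in Ioc (0 : ℝ) 1, (∫⁻ x, ‖z‖ₑ * ‖fderiv ℝ ψ (x + t • z)‖ₑ ∂μ) :=
        lintegral_lintegral_swap hmeas.aemeasurable
    _ = ‖z‖ₑ * ∫⁻ x, ‖fderiv ℝ ψ x‖ₑ ∂μ := by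
        simp_rw [htranslate]
        simp

end Translation

section Averages

theorem enorm_setAverage_sub_le {X F : Type*} [MeasurableSpace X] [NormedAddCommGroup F]
    [NormedSpace ℝ F] [CompleteSpace F] {μ : Measure X} {s : Set X} (hs₀ : μ s ≠ 0) (hs : μ s ≠ ⊤)
    {ψ : X → F} (hψ : IntegrableOn ψ s μ) (c : F) :
    ‖(⨍ w in s, ψ w ∂μ) - c‖ₑ ≤ (μ s)⁻¹ * ∫⁻ w in s, ‖ψ w - c‖ₑ ∂μ := by
  have : IsFiniteMeasure (μ.restrict s) := isFiniteMeasure_restrict.2 hs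
  have : NeZero (μ.restrict s) := ⟨fun h => hs₀ (Measure.restrict_eq_zero.1 h)⟩
  have hsub : (⨍ w in s, ψ w ∂μ) - c = ⨍ w in s, (ψ w - c) ∂μ := by
    conv_lhs => rw [← average_const (μ.restrict s) c]
    exact (integral_sub hψ.integrable.to_average (integrable_const c).to_average).symm
  rw [hsub, average_eq', Measure.restrict_apply_univ]
  refine (enorm_integral_le_lintegral_enorm _).trans_eq ?_
  rw [lintegral_smul_measure, smul_eq_mul]

variable {E F : Type*} [NormedAddCommGroup E] [NormedSpace ℝ E] [FiniteDimensional ℝ E]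
  [MeasurableSpace E] [BorelSpace E] [NormedAddCommGroup F] [NormedSpace ℝ F] [CompleteSpace F]
  {μ : Measure E} [μ.IsAddHaarMeasure] {ψ : E → F} {ε : ℝ}

theorem enorm_setAverage_ball_sub_le (hψ : LocallyIntegrable ψ μ) (hε : 0 < ε) {x y : E}
    (hxy : dist y x < ε) :
    ‖(⨍ w in Metric.ball y ε, ψ w ∂μ) - ψ x‖ₑ ≤ (μ (Metric.ball 0 ε))⁻¹ *
      ∫⁻ z in Metric.ball 0 (2 * ε), ‖ψ (x + z) - ψ x‖ₑ ∂μ := by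
  have hint : IntegrableOn ψ (Metric.ball y ε) μ :=
    (hψ.integrableOn_isCompact (isCompact_closedBall y ε)).mono_set Metric.ball_subset_closedBall
  have hsub : Metric.ball y ε ⊆ Metric.ball x (2 * ε) :=
    Metric.ball_subset_ball' (by linarith)
  have hpre : (x + ·) ⁻¹' Metric.ball x (2 * ε) = Metric.ball 0 (2 * ε) := by
    ext z
    simp [dist_eq_norm]
  calc ‖(⨍ w in Metric.ball y ε, ψ w ∂μ) - ψ x‖ₑ
      ≤ (μ (Metric.ball y ε))⁻¹ * ∫⁻ w in Metric.ball y ε, ‖ψ w - ψ x‖ₑ ∂μ :=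
        enorm_setAverage_sub_le (Metric.measure_ball_pos μ y hε).ne' measure_ball_lt_top.ne hint _
    _ ≤ (μ (Metric.ball 0 ε))⁻¹ * ∫⁻ w in Metric.ball x (2 * ε), ‖ψ w - ψ x‖ₑ ∂μ := by
        rw [Measure.addHaar_ball_center]
        gcongr
    _ = (μ (Metric.ball 0 ε))⁻¹ * ∫⁻ z in Metric.ball 0 (2 * ε), ‖ψ (x + z) - ψ x‖ₑ ∂μ := by
        rw [← hpre, (measurePreserving_add_left μ x).setLIntegral_comp_preimage_emb
          (measurableEmbedding_addLeft x) fun w => ‖ψ w - ψ x‖ₑ]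

theorem lintegral_enorm_setAverage_ball_sub_le (hψ : ContDiff ℝ 1 ψ) (hε : 0 < ε) {Ω : Set E}
    (hΩ : MeasurableSet Ω) {π : E → E} (hπ : ∀ x ∈ Ω, dist (π x) x < ε) :
    ∫⁻ x in Ω, ‖(⨍ w in Metric.ball (π x) ε, ψ w ∂μ) - ψ x‖ₑ ∂μ ≤
      ENNReal.ofReal (2 ^ Module.finrank ℝ E * (2 * ε)) * ∫⁻ x, ‖fderiv ℝ ψ x‖ₑ ∂μ := by
  have hcont : Continuous ψ := hψ.continuous
  set V := μ (Metric.ball (0 : E) ε) with hV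
  have hV₀ : V ≠ 0 := (Metric.measure_ball_pos μ 0 hε).ne'
  have hmeas : Measurable fun y : E × E => ‖ψ (y.1 + y.2) - ψ y.1‖ₑ :=
    Continuous.measurable (by fun_prop)
  calc ∫⁻ x in Ω, ‖(⨍ w in Metric.ball (π x) ε, ψ w ∂μ) - ψ x‖ₑ ∂μ
      ≤ ∫⁻ x in Ω, V⁻¹ * ∫⁻ z in Metric.ball 0 (2 * ε), ‖ψ (x + z) - ψ x‖ₑ ∂μ ∂μ :=
        setLIntegral_mono' hΩ fun x hx =>
          enorm_setAverage_ball_sub_le hcont.locallyIntegrable hε (hπ x hx)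
    _ ≤ ∫⁻ x, V⁻¹ * ∫⁻ z in Metric.ball 0 (2 * ε), ‖ψ (x + z) - ψ x‖ₑ ∂μ ∂μ :=
        setLIntegral_le_lintegral _ _
    _ = V⁻¹ * ∫⁻ z in Metric.ball 0 (2 * ε), ∫⁻ x, ‖ψ (x + z) - ψ x‖ₑ ∂μ ∂μ := by
        rw [lintegral_const_mul' _ _ (ENNReal.inv_ne_top.2 hV₀),
          lintegral_lintegral_swap hmeas.aemeasurable]
    _ ≤ V⁻¹ * ∫⁻ _ in Metric.ball (0 : E) (2 * ε),
          ENNReal.ofReal (2 * ε) * ∫⁻ x, ‖fderiv ℝ ψ x‖ₑ ∂μ ∂μ := by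
        gcongr V⁻¹ * ?_
        refine setLIntegral_mono' measurableSet_ball fun z hz => ?_
        refine (lintegral_enorm_add_sub_le hψ z).trans ?_
        gcongr
        rw [← ofReal_norm]
        exact ENNReal.ofReal_le_ofReal (mem_ball_zero_iff.1 hz).le
    _ = ENNReal.ofReal (2 ^ Module.finrank ℝ E * (2 * ε)) * ∫⁻ x, ‖fderiv ℝ ψ x‖ₑ ∂μ := by
        rw [setLIntegral_const, Measure.addHaar_ball_mul_of_pos μ 0 two_pos, ← hV,
          ENNReal.ofReal_mul (p := 2 ^ Module.finrank ℝ E) (by positivity), mul_comm _ (_ * V),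
          mul_comm _ V, mul_assoc V, ← mul_assoc V⁻¹,
          ENNReal.inv_mul_cancel hV₀ measure_ball_lt_top.ne, one_mul, mul_assoc]

end Averages

section CompactOperators

theorem isCompactOperator_of_forall_norm_comp_sub_le {E F : Type*} [NormedAddCommGroup E]
    [NormedSpace ℝ E] [NormedAddCommGroup F] [NormedSpace ℝ F] [CompleteSpace F] {J : E →L[ℝ] F}
    (h : ∀ ε > 0, ∃ S : F →L[ℝ] F, IsCompactOperator S ∧ ∀ u, ‖S (J u) - J u‖ ≤ ε * ‖u‖) :
    IsCompactOperator J := by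
  choose! S hS hSJ using h
  have hlim : Tendsto (fun n : ℕ => (S (1 / ((n : ℝ) + 1))).comp J) atTop (𝓝 J) := by
    rw [tendsto_iff_norm_sub_tendsto_zero]
    exact squeeze_zero (fun n => norm_nonneg _)
      (fun n => ContinuousLinearMap.opNorm_le_bound _ (by positivity)
        (hSJ _ Nat.one_div_pos_of_nat)) tendsto_one_div_add_atTop_nhds_zero_nat
  exact isCompactOperator_of_tendsto hlim
    (Eventually.of_forall fun n => (hS _ Nat.one_div_pos_of_nat).comp_clm J)

theorem exists_isCompactOperator_coeFn_eq {X β E : Type*} [MeasurableSpace X] {μ : Measure X}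
    [IsFiniteMeasure μ] [NormedAddCommGroup E] [NormedSpace ℝ E] (π : SimpleFunc X β)
    (ℓ : β → E →L[ℝ] ℝ) (q : ℝ≥0∞) [Fact (1 ≤ q)] :
    ∃ S : E →L[ℝ] Lp ℝ q μ, IsCompactOperator S ∧ ∀ u, S u =ᵐ[μ] fun x => ℓ (π x) u := by
  classical
  let g : (π.range → ℝ) → SimpleFunc X ℝ := fun c =>
    π.map fun y => if h : y ∈ π.range then c ⟨y, h⟩ else 0
  have hmem : ∀ c, MemLp (g c) q μ := fun c => (g c).memLp_of_isFiniteMeasure q μ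
  let A : (π.range → ℝ) →ₗ[ℝ] Lp ℝ q μ :=
    { toFun := fun c => (hmem c).toLp
      map_add' := fun c d => by
        rw [← MemLp.toLp_add]
        refine MemLp.toLp_congr _ _ (ae_of_all _ fun x => ?_)
        simp [g]
      map_smul' := fun k c => by
        rw [RingHom.id_apply, ← MemLp.toLp_const_smul]
        refine MemLp.toLp_congr _ _ (ae_of_all _ fun x => ?_)
        simp [g] }
  refine ⟨(LinearMap.toContinuousLinearMap A).comp (ContinuousLinearMap.pi fun y : π.range => ℓ y),
    (isCompactOperator_of_locallyCompactSpace_rng (LinearMap.toContinuousLinearMap A)).comp_clm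
      (ContinuousLinearMap.pi fun y : π.range => ℓ y), fun u => ?_⟩
  refine (hmem _).coeFn_toLp.trans (ae_of_all _ fun x => ?_)
  simp [g]

theorem exists_simpleFunc_dist_lt {X : Type*} [PseudoMetricSpace X]
    [TopologicalSpace.SeparableSpace X] [Nonempty X] [MeasurableSpace X] [OpensMeasurableSpace X]
    {K : Set X} (hK : IsCompact K) {ε : ℝ} (hε : 0 < ε) :
    ∃ π : SimpleFunc X X, ∀ x ∈ K, dist (π x) x < ε := by
  let e := TopologicalSpace.denseSeq X
  obtain ⟨t, ht⟩ := hK.elim_finite_subcover (fun k : ℕ => Metric.ball (e k) ε)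
    (fun _ => Metric.isOpen_ball) fun x _ => by
      obtain ⟨k, hk⟩ := (TopologicalSpace.denseRange_denseSeq X).exists_dist_lt x hε
      exact mem_iUnion.2 ⟨k, hk⟩
  refine ⟨SimpleFunc.nearestPt e (t.sup id), fun x hx => ?_⟩
  obtain ⟨k, hk, hxk⟩ := mem_iUnion₂.1 (ht hx)
  have hnearest := SimpleFunc.edist_nearestPt_le e x (Finset.le_sup (f := id) hk)
  rw [edist_dist, edist_dist, ENNReal.ofReal_le_ofReal_iff dist_nonneg] at hnearest
  rw [Metric.mem_ball, dist_comm] at hxk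
  exact hnearest.trans_lt hxk

/-- The integral over `s` as a bounded functional on `L¹(μ)`. -/
def setIntegralCLM {X : Type*} [MeasurableSpace X] (μ : Measure X) (s : Set X) :
    Lp ℝ 1 μ →L[ℝ] ℝ :=
  (L1.integralCLM).comp (LpToLpRestrictCLM X ℝ ℝ μ 1 s)

theorem setIntegralCLM_apply {X : Type*} [MeasurableSpace X] {μ : Measure X} (s : Set X)
    (u : Lp ℝ 1 μ) : setIntegralCLM μ s u = ∫ x in s, u x ∂μ := by
  rw [setIntegralCLM, ContinuousLinearMap.comp_apply, ← L1.integral_eq, L1.integral_eq_integral]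
  exact integral_congr_ae (LpToLpRestrictCLM_coeFn ℝ s u)

end CompactOperators

section Rellich

variable {N : ℕ} {Ω : Set (RN N)} {p : ℝ}

theorem setIntegral_restrict_of_support_subset {X : Type*} [MeasurableSpace X] {μ : Measure X}
    {s Ω : Set X} (hs : MeasurableSet s) {ψ : X → ℝ} (hψ : Function.support ψ ⊆ Ω) :
    ∫ x in s, ψ x ∂μ.restrict Ω = ∫ x in s, ψ x ∂μ := by
  rw [Measure.restrict_restrict hs]
  exact (setIntegral_eq_of_subset_of_forall_sdiff_eq_zero hs inter_subset_left fun x hx =>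
    Function.notMem_support.1 fun h => hx.2 ⟨hx.1, hψ h⟩).symm

/- The finite-rank operator assigns to `x` the average of `u` over a ball around a nearby point of a
finite net. -/
theorem exists_isCompactOperator_enorm_sub_le (hb : Bornology.IsBounded Ω)
    (hΩ : MeasurableSet Ω) {ε : ℝ} (hε : 0 < ε) :
    ∃ S : Lp ℝ 1 (volume.restrict Ω) →L[ℝ] Lp ℝ 1 (volume.restrict Ω), IsCompactOperator S ∧
      ∀ (u : Lp ℝ 1 (volume.restrict Ω)) (ψ : RN N → ℝ), IsTestFunction Ω ψ →
        u =ᵐ[volume.restrict Ω] ψ →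
        ‖S u - u‖ₑ ≤ ENNReal.ofReal (2 ^ N * (2 * ε)) * ∫⁻ x, ‖fderiv ℝ ψ x‖ₑ := by
  have : Fact (volume Ω < ⊤) := ⟨hb.measure_lt_top⟩
  obtain ⟨π, hπ⟩ := exists_simpleFunc_dist_lt hb.isCompact_closure hε
  obtain ⟨S, hS, hSu⟩ := exists_isCompactOperator_coeFn_eq (μ := volume.restrict Ω) π
    (fun y => (volume.real (Metric.ball y ε))⁻¹ •
      setIntegralCLM (volume.restrict Ω) (Metric.ball y ε)) 1
  refine ⟨S, hS, fun u ψ hψ hu => ?_⟩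
  have hae : (S u - u : Lp ℝ 1 (volume.restrict Ω)) =ᵐ[volume.restrict Ω]
      fun x => (⨍ w in Metric.ball (π x) ε, ψ w) - ψ x := by
    filter_upwards [Lp.coeFn_sub (S u) u, hSu u, hu] with x hsub hSx hux
    rw [hsub, Pi.sub_apply, hSx, hux, smul_apply, setIntegralCLM_apply,
      integral_congr_ae (ae_restrict_of_ae hu),
      setIntegral_restrict_of_support_subset measurableSet_ball hψ.support_subset, setAverage_eq]
  rw [Lp.enorm_def, eLpNorm_congr_ae hae, eLpNorm_one_eq_lintegral_enorm]
  simpa using lintegral_enorm_setAverage_ball_sub_le (μ := volume) (hψ.contDiff.of_le (by simp)) hε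
    hΩ fun x hx => hπ x (subset_closure hx)

theorem W1p0.exists_isCompactOperator_norm_sub_le [Fact (1 < p)] (hb : Bornology.IsBounded Ω)
    (hΩ : MeasurableSet Ω) {J : W1p0 Ω p →L[ℝ] Lp ℝ 1 (volume.restrict Ω)}
    (hJ : ∀ u, J u =ᵐ[volume.restrict Ω] u.fn) {ε : ℝ} (hε : 0 < ε) :
    ∃ S : Lp ℝ 1 (volume.restrict Ω) →L[ℝ] Lp ℝ 1 (volume.restrict Ω), IsCompactOperator S ∧
      ∀ u, ‖S (J u) - J u‖ ≤ ε * ‖u‖ := by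
  obtain ⟨C, hC⟩ := exists_eLpNorm_gradient_le_of_le hb one_pos (Fact.out : 1 < p).le
  obtain ⟨S, hS, hSJ⟩ := exists_isCompactOperator_enorm_sub_le hb hΩ
    (by positivity : 0 < ε / (2 ^ N * 2 * (C + 1)))
  refine ⟨S, hS, fun u => ?_⟩
  obtain ⟨w, ψ, hw, hψ⟩ := u.exists_tendsto_testFunction
  have hleft : Continuous fun u : W1p0 Ω p => ‖S (J u) - J u‖ := by fun_prop
  have hright : Continuous fun u : W1p0 Ω p => ε * ‖u‖ := by fun_prop
  refine le_of_tendsto_of_tendsto' ((hleft.tendsto u).comp hw) ((hright.tendsto u).comp hw)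
    fun n => ?_
  have hgrad : ∫⁻ x, ‖fderiv ℝ (ψ n) x‖ₑ ≤ C * ‖gradL Ω p (w n)‖ₑ := by
    rw [← eLpNorm_one_eq_lintegral_enorm, (hψ n).1.eLpNorm_fderiv, Lp.enorm_def, coe_gradL,
      eLpNorm_congr_ae (hψ n).2.2, ← ENNReal.ofReal_one]
    exact hC _ (hψ n).1
  have henorm := (hSJ _ _ (hψ n).1 ((hJ (w n)).trans (hψ n).2.1)).trans
    (mul_le_mul_right hgrad _)
  have hnorm := ENNReal.toReal_mono (by finiteness) henorm
  rw [toReal_enorm, ENNReal.toReal_mul, ENNReal.toReal_mul, toReal_enorm,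
    ENNReal.toReal_ofReal (by positivity), ENNReal.coe_toReal] at hnorm
  calc ‖S (J (w n)) - J (w n)‖
      ≤ 2 ^ N * (2 * (ε / (2 ^ N * 2 * (C + 1)))) * (C * ‖gradL Ω p (w n)‖) := hnorm
    _ = C / (C + 1) * (ε * ‖gradL Ω p (w n)‖) := by field_simp
    _ ≤ 1 * (ε * ‖w n‖) := by
        gcongr
        · exact div_le_one_of_le₀ (by simp) (by positivity)
        · exact (w n).norm_gradL_le
    _ = ε * ‖w n‖ := one_mul _

theorem W1p0.isCompactOperator_embedding [Fact (1 < p)] (hb : Bornology.IsBounded Ω)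
    (hΩ : MeasurableSet Ω) {J : W1p0 Ω p →L[ℝ] Lp ℝ 1 (volume.restrict Ω)}
    (hJ : ∀ u, J u =ᵐ[volume.restrict Ω] u.fn) : IsCompactOperator J :=
  isCompactOperator_of_forall_norm_comp_sub_le fun _ hε =>
    exists_isCompactOperator_norm_sub_le hb hΩ hJ hε

end Rellich

section Interpolation

variable {X : Type*} [MeasurableSpace X] {μ : Measure X} {τ r q : ℝ}

theorem integral_rpow_mul_rpow_le {f g : X → ℝ} (hf : Integrable f μ) (hg : Integrable g μ)
    (hf0 : ∀ x, 0 ≤ f x) (hg0 : ∀ x, 0 ≤ g x) {a b : ℝ} (ha : 0 ≤ a) (hb : 0 ≤ b)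
    (hab : a + b = 1) :
    ∫ x, f x ^ a * g x ^ b ∂μ ≤ (∫ x, f x ∂μ) ^ a * (∫ x, g x ∂μ) ^ b := by
  have hfi : 0 ≤ ∫ x, f x ∂μ := integral_nonneg hf0
  have hgi : 0 ≤ ∫ x, g x ∂μ := integral_nonneg hg0
  rw [integral_eq_lintegral_of_nonneg_ae
    (ae_of_all _ fun x => mul_nonneg (Real.rpow_nonneg (hf0 x) _) (Real.rpow_nonneg (hg0 x) _))
    ((hf.1.aemeasurable.pow_const a).mul (hg.1.aemeasurable.pow_const b)).aestronglyMeasurable]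
  refine ENNReal.toReal_le_of_le_ofReal (by positivity) ?_
  rw [ENNReal.ofReal_mul (by positivity), ← ENNReal.ofReal_rpow_of_nonneg hfi ha,
    ← ENNReal.ofReal_rpow_of_nonneg hgi hb,
    ofReal_integral_eq_lintegral_ofReal hf (ae_of_all _ hf0),
    ofReal_integral_eq_lintegral_ofReal hg (ae_of_all _ hg0)]
  refine le_of_eq_of_le (lintegral_congr fun x => ?_) (ENNReal.lintegral_mul_norm_pow_le
    hf.1.aemeasurable.ennreal_ofReal hg.1.aemeasurable.ennreal_ofReal ha hb hab)
  rw [ENNReal.ofReal_mul (Real.rpow_nonneg (hf0 x) _), ENNReal.ofReal_rpow_of_nonneg (hf0 x) ha,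
    ENNReal.ofReal_rpow_of_nonneg (hg0 x) hb]

theorem integral_rpow_le_interpolation (hτr : τ < r) (hrq : r < q) (hr : r ≠ 0) {f : X → ℝ}
    (hf0 : ∀ x, 0 ≤ f x) (hfτ : Integrable (fun x => f x ^ τ) μ)
    (hfq : Integrable (fun x => f x ^ q) μ) :
    ∫ x, f x ^ r ∂μ ≤ (∫ x, f x ^ τ ∂μ) ^ ((q - r) / (q - τ)) *
      (∫ x, f x ^ q ∂μ) ^ ((r - τ) / (q - τ)) := by
  have hqτ : 0 < q - τ := by linarith
  have hsum : (q - r) / (q - τ) + (r - τ) / (q - τ) = 1 := by field_simp; ring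
  have hexp : τ * ((q - r) / (q - τ)) + q * ((r - τ) / (q - τ)) = r := by field_simp; ring
  have hpow : ∀ x, f x ^ r = (f x ^ τ) ^ ((q - r) / (q - τ)) * (f x ^ q) ^ ((r - τ) / (q - τ)) :=
    fun x => by
      rw [← Real.rpow_mul (hf0 x), ← Real.rpow_mul (hf0 x),
        ← Real.rpow_add' (hf0 x) (by rwa [hexp]), hexp]
  simp only [hpow]
  exact integral_rpow_mul_rpow_le hfτ hfq (fun x => Real.rpow_nonneg (hf0 x) _)
    (fun x => Real.rpow_nonneg (hf0 x) _) (div_nonneg (by linarith) hqτ.le)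
    (div_nonneg (by linarith) hqτ.le) hsum

theorem norm_rpow_le_interpolation {E : Type*} [NormedAddCommGroup E] (hr : 1 < r) (hrq : r < q)
    {f : Lp E 1 μ} {g : Lp E (ENNReal.ofReal r) μ} {h : Lp E (ENNReal.ofReal q) μ}
    (hfg : f =ᵐ[μ] g) (hgh : g =ᵐ[μ] h) :
    ‖g‖ ^ r ≤ ‖f‖ ^ ((q - r) / (q - 1)) * (‖h‖ ^ q) ^ ((r - 1) / (q - 1)) := by
  have hf : ‖f‖ = ∫ x, ‖f x‖ ^ (1 : ℝ) ∂μ := by simp [L1.norm_eq_integral_norm]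
  have hg : ‖g‖ ^ r = ∫ x, ‖f x‖ ^ r ∂μ := by
    rw [norm_rpow_eq_integral_norm_rpow (by linarith)]
    exact integral_congr_ae (hfg.mono fun x hx => by simp only [hx])
  have hpow : (fun x => ‖h x‖ ^ q) =ᵐ[μ] fun x => ‖f x‖ ^ q :=
    (hfg.trans hgh).mono fun x hx => by simp only [hx]
  rw [hg, hf, norm_rpow_eq_integral_norm_rpow (by linarith) h, integral_congr_ae hpow]
  exact integral_rpow_le_interpolation hr hrq (by linarith) (fun x => norm_nonneg _)
    (by simpa using (L1.integrable_coeFn f).norm)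
    ((integrable_norm_rpow_coeFn (by linarith) h).congr hpow)

end Interpolation

section CauchySeq

variable {Y Z : Type*} [SeminormedAddCommGroup Y] [SeminormedAddCommGroup Z]

theorem cauchySeq_of_tendsto_norm_sub_rpow {y : ℕ → Y} {r : ℝ} (hr : 0 < r)
    (h : Tendsto (fun n : ℕ × ℕ => ‖y n.1 - y n.2‖ ^ r) atTop (𝓝 0)) : CauchySeq y := by
  rw [cauchySeq_iff_tendsto_dist_atTop_0]
  have hroot := h.rpow_const (p := r⁻¹) (Or.inr (by positivity))
  rw [Real.zero_rpow (by positivity)] at hroot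
  exact hroot.congr fun n => by rw [Real.rpow_rpow_inv (norm_nonneg _) hr.ne', dist_eq_norm]

theorem cauchySeq_of_norm_sub_rpow_le {y : ℕ → Y} {z : ℕ → Z} {r a K : ℝ} (hr : 0 < r)
    (ha : 0 < a) (h : ∀ i j, ‖y i - y j‖ ^ r ≤ ‖z i - z j‖ ^ a * K) (hz : CauchySeq z) :
    CauchySeq y := by
  refine cauchySeq_of_tendsto_norm_sub_rpow hr
    (squeeze_zero (fun _ => by positivity) (fun n => h n.1 n.2) ?_)
  have hlim := ((cauchySeq_iff_tendsto_dist_atTop_0.1 hz).rpow_const (p := a)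
    (Or.inr ha.le)).mul_const K
  simpa only [dist_eq_norm, Real.zero_rpow ha.ne', zero_mul] using hlim

end CauchySeq

namespace W1p0

variable {N : ℕ} {Ω : Set (RN N)} {p r : ℝ} [Fact (1 < p)]

theorem exists_norm_rpow_le_norm_rpow_mul (hN : 1 ≤ N) (hb : Bornology.IsBounded Ω)
    (hr : 1 < r) (hrc : (r : EReal) < critExp N p) [Fact (1 ≤ ENNReal.ofReal r)]
    {J₁ : W1p0 Ω p →L[ℝ] Lp ℝ 1 (volume.restrict Ω)}
    (hJ₁ : ∀ u, J₁ u =ᵐ[volume.restrict Ω] u.fn)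
    {J : W1p0 Ω p →L[ℝ] Lp ℝ (ENNReal.ofReal r) (volume.restrict Ω)}
    (hJ : ∀ u, J u =ᵐ[volume.restrict Ω] u.fn) :
    ∃ a > (0 : ℝ), ∃ b ≥ (0 : ℝ), ∃ C : ℝ, ∀ u, ‖J u‖ ^ r ≤ ‖J₁ u‖ ^ a * (C * ‖u‖ ^ b) := by
  obtain ⟨q, hrq, hqc⟩ := exists_gt_le_critExp hrc
  have : Fact (1 ≤ ENNReal.ofReal q) := ⟨ENNReal.one_le_ofReal.2 (by linarith)⟩
  obtain ⟨Jq, C, hJq, hC⟩ := exists_sobolev_embedding (Ω := Ω) hN hb hqc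
  have hq1 : 0 < q - 1 := by linarith
  have hθ : 0 ≤ (r - 1) / (q - 1) := div_nonneg (by linarith) hq1.le
  refine ⟨(q - r) / (q - 1), div_pos (by linarith) hq1, q * ((r - 1) / (q - 1)),
    mul_nonneg (by linarith) hθ, (C : ℝ) ^ (q * ((r - 1) / (q - 1))), fun u => ?_⟩
  refine (norm_rpow_le_interpolation hr hrq ((hJ₁ u).trans (hJ u).symm)
    ((hJ u).trans (hJq u).symm)).trans ?_
  rw [← Real.rpow_mul (norm_nonneg _), ← Real.mul_rpow C.coe_nonneg (norm_nonneg _)]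
  gcongr
  · exact mul_nonneg (by linarith) hθ
  · exact (hC u).trans (mul_le_mul_of_nonneg_left u.norm_gradL_le C.2)

theorem exists_subseq_tendsto (hN : 1 ≤ N) (hb : Bornology.IsBounded Ω) (hΩ : MeasurableSet Ω)
    (hr : 1 < r) (hrc : (r : EReal) < critExp N p) [Fact (1 ≤ ENNReal.ofReal r)]
    {J : W1p0 Ω p →L[ℝ] Lp ℝ (ENNReal.ofReal r) (volume.restrict Ω)}
    (hJ : ∀ u, J u =ᵐ[volume.restrict Ω] u.fn) {u : ℕ → W1p0 Ω p} {R : ℝ} (hR : ∀ n, ‖u n‖ ≤ R) :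
    ∃ y, ∃ k : ℕ → ℕ, StrictMono k ∧ Tendsto (fun n => J (u (k n))) atTop (𝓝 y) := by
  obtain ⟨C₁, hC₁⟩ := exists_eLpNorm_fn_le (Ω := Ω) hN hb one_pos
    ((EReal.coe_le_coe_iff.2 hr.le).trans hrc.le)
  rw [ENNReal.ofReal_one] at hC₁
  obtain ⟨J₁, hJ₁, -⟩ := exists_embedding_of_eLpNorm_le hC₁
  obtain ⟨a, ha, b, hb0, C, hC⟩ := exists_norm_rpow_le_norm_rpow_mul hN hb hr hrc hJ₁ hJ
  obtain ⟨K, hK, hKs⟩ := (isCompactOperator_embedding hb hΩ hJ₁).image_closedBall_subset_compact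
    (𝕜₁ := ℝ) (f := (J₁ : W1p0 Ω p →ₗ[ℝ] Lp ℝ 1 (volume.restrict Ω))) R
  obtain ⟨y₁, -, k, hk, hlim⟩ := hK.tendsto_subseq
    fun n => hKs ⟨u n, mem_closedBall_zero_iff.2 (hR n), rfl⟩
  have hcauchy : CauchySeq fun n => J (u (k n)) := by
    refine cauchySeq_of_norm_sub_rpow_le (z := fun n => J₁ (u (k n))) (K := |C| * (2 * R) ^ b)
      (zero_lt_one.trans hr) ha (fun i j => ?_) hlim.cauchySeq
    rw [← map_sub, ← map_sub]
    refine (hC _).trans ?_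
    gcongr
    · exact le_abs_self C
    · exact (norm_sub_le _ _).trans (by linarith [hR (k i), hR (k j)])
  obtain ⟨y, hy⟩ := cauchySeq_tendsto_of_complete hcauchy
  exact ⟨y, k, hk, hy⟩

end W1p0

/-- The monotonicity estimate of the gradients of uniformly convex energies of growth `p`. For
`p < 2` it only holds with the error term. -/
def IsAlmostUniformlyMonotone {Z : Type*} [NormedAddCommGroup Z] [NormedSpace ℝ Z] (p : ℝ)
    (A : Z → Z →L[ℝ] ℝ) : Prop :=
  ∀ δ > 0, ∃ C, ∀ z w, ‖z - w‖ ^ p ≤ C * (A z - A w) (z - w) + δ * (‖z‖ ^ p + ‖w‖ ^ p)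

namespace IsPLaplaceLike

variable {X : Type*} [MeasurableSpace X] {μ : Measure X} {N : ℕ} {p p' : ℝ} {a₀ : ℝ → ℝ}

theorem isNemytskii (h : IsPLaplaceLike p a₀) (hp : p.HolderConjugate p') :
    IsNemytskii μ p p' fun _ : X => aMap N a₀ := by
  obtain ⟨B, hB⟩ := h.exists_norm_aMap_le (N := N) hp.lt
  exact .of_norm_le hp (fun _ => aestronglyMeasurable_const)
    (ae_of_all _ fun _ => continuous_aMap h.continuousOn) (ae_of_all _ fun _ => hB)

theorem isPotential (h : IsPLaplaceLike p a₀) :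
    IsPotential μ (fun _ : X => GFun N a₀) fun _ => aMap N a₀ :=
  ⟨ae_of_all _ fun _ => by simp [GFun, G₀],
    ae_of_all _ fun _ => hasGradientAt_GFun h.continuousOn⟩

variable [IsFiniteMeasure μ] [Fact (1 ≤ ENNReal.ofReal p)] [Fact (1 ≤ ENNReal.ofReal p')]

theorem exists_norm_rpow_le_pairing (h : IsPLaplaceLike p a₀) (hp : p.HolderConjugate p') :
    ∃ c > 0, ∀ z : Lp (RN N) (ENNReal.ofReal p) μ,
      c * ‖z‖ ^ p ≤ (h.isNemytskii hp).pairing hp z z := by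
  obtain ⟨c, hc, hle⟩ := h.exists_norm_rpow_le_inner (N := N) hp.lt
  refine ⟨c, hc, fun z => ?_⟩
  rw [IsNemytskii.pairing_apply, norm_rpow_eq_integral_norm_rpow hp.pos, ← integral_const_mul]
  exact integral_mono ((integrable_norm_rpow_coeFn hp.pos z).const_mul c)
    ((h.isNemytskii hp).integrable_inner hp z z) fun x => hle (z x)

theorem exists_pairing_le_mul_integral (h : IsPLaplaceLike p a₀) (hp : p.HolderConjugate p') :
    ∃ C, ∀ z : Lp (RN N) (ENNReal.ofReal p) μ,
      (h.isNemytskii hp).pairing hp z z ≤ p * (∫ x, GFun N a₀ (z x) ∂μ) + C := by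
  obtain ⟨C, hC⟩ := h.exists_inner_le_mul_GFun (N := N)
  refine ⟨μ.real univ * C, fun z => ?_⟩
  have hG : Integrable (fun x => p * GFun N a₀ (z x)) μ :=
    (h.isPotential.integrable (h.isNemytskii hp) hp z).const_mul p
  rw [IsNemytskii.pairing_apply, ← integral_const_mul, ← smul_eq_mul (μ.real univ),
    ← integral_const, ← integral_add hG (integrable_const C)]
  exact integral_mono ((h.isNemytskii hp).integrable_inner hp z z)
    (hG.add (integrable_const C)) fun x => hC (z x)

theorem isAlmostUniformlyMonotone_pairing (h : IsPLaplaceLike p a₀) (hp : p.HolderConjugate p') :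
    IsAlmostUniformlyMonotone p ((h.isNemytskii (N := N) (μ := μ) hp).pairing hp) := by
  intro δ hδ
  obtain ⟨C, hle⟩ := h.exists_norm_sub_rpow_le (N := N) hp.lt hδ
  refine ⟨C, fun z w => ?_⟩
  have hz := (h.isNemytskii hp).integrable_inner hp z (z - w)
  have hw := (h.isNemytskii hp).integrable_inner hp w (z - w)
  have hinner : Integrable (fun x => C * (inner ℝ (aMap N a₀ (z x)) ((z - w) x) -
      inner ℝ (aMap N a₀ (w x)) ((z - w) x))) μ := (hz.sub hw).const_mul C
  have hnorm_z := integrable_norm_rpow_coeFn hp.pos z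
  have hnorm_w := integrable_norm_rpow_coeFn hp.pos w
  have hnorm : Integrable (fun x => δ * (‖z x‖ ^ p + ‖w x‖ ^ p)) μ :=
    (hnorm_z.add hnorm_w).const_mul δ
  rw [sub_apply, IsNemytskii.pairing_apply, IsNemytskii.pairing_apply,
    norm_rpow_eq_integral_norm_rpow hp.pos, norm_rpow_eq_integral_norm_rpow hp.pos,
    norm_rpow_eq_integral_norm_rpow hp.pos, ← integral_sub hz hw, ← integral_add hnorm_z hnorm_w,
    ← integral_const_mul, ← integral_const_mul, ← integral_add hinner hnorm]
  refine integral_mono_ae (integrable_norm_rpow_coeFn hp.pos _) (hinner.add hnorm) ?_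
  filter_upwards [Lp.coeFn_sub z w] with x hx
  simp only [hx, Pi.sub_apply, ← inner_sub_left]
  exact hle (z x) (w x)

end IsPLaplaceLike

section QuasiSuperlinear

variable {X : Type*} [MeasurableSpace X] {μ : Measure X} {p r r' τ : ℝ} {F g : X → ℝ → ℝ}
  {m : ℝ → ℝ}

/-- The reactions `g` with primitive `F` for which `g(·, s) s` is dominated by `m(s) ^ r` and
`g(·, s) s - p F(·, s)` dominates `m(s) ^ τ`, up to constants. The gauge `m` is `|s|` for a full
reaction, and the positive or the negative part of `s` for a truncated one. -/
structure IsQuasiSuperlinear (μ : Measure X) (p r τ : ℝ) (F g : X → ℝ → ℝ) (m : ℝ → ℝ) :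
    Prop where
  measurable : Measurable m
  nonneg : ∀ s, 0 ≤ m s
  le_abs : ∀ s, m s ≤ |s|
  upper : ∃ A ≥ 0, ∀ᵐ x ∂μ, ∀ s, g x s * s ≤ A * (1 + m s ^ r)
  lower : ∃ β > 0, ∃ C, ∀ᵐ x ∂μ, ∀ s, β * m s ^ τ - C ≤ g x s * s - p * F x s

theorem IsQuasiSuperlinear.aestronglyMeasurable_rpow (hm : IsQuasiSuperlinear μ p r τ F g m)
    {w : X → ℝ} (hw : AEStronglyMeasurable w μ) (t : ℝ) :
    AEStronglyMeasurable (fun x => m (w x) ^ t) μ :=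
  ((hm.measurable.comp_aemeasurable hw.aemeasurable).pow_const t).aestronglyMeasurable

theorem IsQuasiSuperlinear.integrable_rpow (hm : IsQuasiSuperlinear μ p r τ F g m) {q : ℝ}
    (hq : 0 < q) (w : Lp ℝ (ENNReal.ofReal q) μ) : Integrable (fun x => m (w x) ^ q) μ := by
  refine (integrable_norm_rpow_coeFn hq w).mono'
    (hm.aestronglyMeasurable_rpow (Lp.aestronglyMeasurable w) q) (ae_of_all _ fun x => ?_)
  rw [Real.norm_of_nonneg (Real.rpow_nonneg (hm.nonneg _) _)]
  exact Real.rpow_le_rpow (hm.nonneg _) (hm.le_abs _) hq.le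

theorem IsQuasiSuperlinear.integral_rpow_le_norm_rpow (hm : IsQuasiSuperlinear μ p r τ F g m)
    {q : ℝ} (hq : 0 < q) (w : Lp ℝ (ENNReal.ofReal q) μ) : ∫ x, m (w x) ^ q ∂μ ≤ ‖w‖ ^ q := by
  rw [norm_rpow_eq_integral_norm_rpow hq]
  exact integral_mono (hm.integrable_rpow hq w) (integrable_norm_rpow_coeFn hq w)
    fun x => Real.rpow_le_rpow (hm.nonneg _) (hm.le_abs _) hq.le

variable [IsFiniteMeasure μ] [Fact (1 ≤ ENNReal.ofReal r)] [Fact (1 ≤ ENNReal.ofReal r')]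

theorem IsNemytskii.integrable_mul_self (hg : IsNemytskii μ r r' g) (hr : r.HolderConjugate r')
    (w : Lp ℝ (ENNReal.ofReal r) μ) : Integrable (fun x => g x (w x) * w x) μ :=
  (hg.integrable_inner hr w w).congr (ae_of_all _ fun x => by simp [mul_comm])

theorem IsNemytskii.pairing_self (hg : IsNemytskii μ r r' g) (hr : r.HolderConjugate r')
    (w : Lp ℝ (ENNReal.ofReal r) μ) : hg.pairing hr w w = ∫ x, g x (w x) * w x ∂μ := by
  rw [hg.pairing_apply]
  exact integral_congr_ae (ae_of_all _ fun x => by simp [mul_comm])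

theorem IsQuasiSuperlinear.exists_pairing_le (hm : IsQuasiSuperlinear μ p r τ F g m)
    (hg : IsNemytskii μ r r' g) (hr : r.HolderConjugate r') :
    ∃ A ≥ 0, ∀ w : Lp ℝ (ENNReal.ofReal r) μ,
      hg.pairing hr w w ≤ A * (μ.real univ + ∫ x, m (w x) ^ r ∂μ) := by
  obtain ⟨A, hA, hle⟩ := hm.upper
  refine ⟨A, hA, fun w => ?_⟩
  have hr_int := hm.integrable_rpow hr.pos w
  rw [hg.pairing_self, ← mul_one (μ.real univ), ← smul_eq_mul (μ.real univ), ← integral_const,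
    ← integral_add (integrable_const 1) hr_int, ← integral_const_mul]
  exact integral_mono_ae (hg.integrable_mul_self hr w)
    (((integrable_const 1).add hr_int).const_mul A) (hle.mono fun x hx => hx (w x))

theorem IsQuasiSuperlinear.exists_integral_rpow_le (hm : IsQuasiSuperlinear μ p r τ F g m)
    (hF : IsPotential μ F g) (hg : IsNemytskii μ r r' g) (hr : r.HolderConjugate r') :
    ∃ β > 0, ∃ C, ∀ w : Lp ℝ (ENNReal.ofReal r) μ, Integrable (fun x => m (w x) ^ τ) μ ∧
      β * (∫ x, m (w x) ^ τ ∂μ) ≤ hg.pairing hr w w - p * (∫ x, F x (w x) ∂μ) + C := by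
  obtain ⟨β, hβ, C, hle⟩ := hm.lower
  refine ⟨β, hβ, μ.real univ * C, fun w => ?_⟩
  have hF_int : Integrable (fun x => p * F x (w x)) μ := (hF.integrable hg hr w).const_mul p
  have hsub : Integrable (fun x => g x (w x) * w x - p * F x (w x)) μ :=
    (hg.integrable_mul_self hr w).sub hF_int
  have hbound : Integrable (fun x => g x (w x) * w x - p * F x (w x) + C) μ :=
    hsub.add (integrable_const C)
  have hτ : Integrable (fun x => β * m (w x) ^ τ) μ := by
    refine hbound.mono' ((hm.aestronglyMeasurable_rpow (Lp.aestronglyMeasurable w) τ).const_mul β)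
      (hle.mono fun x hx => ?_)
    rw [Real.norm_of_nonneg (mul_nonneg hβ.le (Real.rpow_nonneg (hm.nonneg _) _))]
    linarith [hx (w x)]
  refine ⟨by simpa [mul_assoc, hβ.ne'] using hτ.const_mul β⁻¹, ?_⟩
  rw [hg.pairing_self, ← integral_const_mul, ← integral_const_mul, ← smul_eq_mul (μ.real univ),
    ← integral_const, ← integral_sub (hg.integrable_mul_self hr w) hF_int,
    ← integral_add hsub (integrable_const C)]
  exact integral_mono_ae hτ hbound (hle.mono fun x hx => by linarith [hx (w x)])

end QuasiSuperlinear

section APrioriBound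

variable {X : Type*} [MeasurableSpace X] {μ : Measure X} {p q r τ : ℝ}

theorem exists_le_of_mul_le_add_mul_rpow {c s : ℝ} (hc : 0 < c) (hs : s < 1) (C₁ C₂ : ℝ) :
    ∃ B, ∀ x : ℝ, c * x ≤ C₁ + C₂ * x ^ s → x ≤ B := by
  have hlim : Tendsto (fun x : ℝ => C₁ * x⁻¹ + C₂ * x ^ (s - 1)) atTop (𝓝 0) := by
    have h := tendsto_rpow_neg_atTop (sub_pos.2 hs)
    rw [neg_sub] at h
    simpa using (tendsto_inv_atTop_zero.const_mul C₁).add (h.const_mul C₂)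
  obtain ⟨B, hB⟩ := eventually_atTop.1 ((hlim.eventually_lt_const hc).and (eventually_gt_atTop 0))
  refine ⟨B, fun x hx => le_of_not_ge fun hBx => ?_⟩
  obtain ⟨hlt, hx0⟩ := hB x hBx
  refine absurd hx (not_le.2 ?_)
  calc C₁ + C₂ * x ^ s = (C₁ * x⁻¹ + C₂ * x ^ (s - 1)) * x := by
        rw [Real.rpow_sub_one hx0.ne']
        field_simp
    _ < c * x := mul_lt_mul_of_pos_right hlt hx0

variable [IsFiniteMeasure μ]

theorem integral_rpow_le_measureReal_univ_add (hr : 0 ≤ r) (hrτ : r ≤ τ) {f : X → ℝ}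
    (hf0 : ∀ x, 0 ≤ f x) (hfτ : Integrable (fun x => f x ^ τ) μ) :
    ∫ x, f x ^ r ∂μ ≤ μ.real univ + ∫ x, f x ^ τ ∂μ := by
  rw [← mul_one (μ.real univ), ← smul_eq_mul, ← integral_const,
    ← integral_add (integrable_const 1) hfτ]
  refine integral_mono_of_nonneg (ae_of_all _ fun x => Real.rpow_nonneg (hf0 x) _)
    ((integrable_const 1).add hfτ) (ae_of_all _ fun x => ?_)
  rcases le_total (f x) 1 with hle | hge
  · exact (Real.rpow_le_one (hf0 x) hle hr).trans
      (le_add_of_nonneg_right (Real.rpow_nonneg (hf0 x) τ))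
  · exact (Real.rpow_le_rpow_of_exponent_le hge hrτ).trans (le_add_of_nonneg_left zero_le_one)

/-- The condition `q (r - p) < τ (q - p)` is exactly what makes the exponent `s` smaller than `1`
after interpolating `r` between `τ` and `q`. -/
theorem exists_integral_rpow_le_add_mul_rpow (hp : 0 < p) (hpr : p < r) (hrq : r < q)
    (hqτ : q * (r - p) < τ * (q - p)) {K D : ℝ} (hK : 0 ≤ K) (hD : 0 ≤ D) :
    ∃ C₁ C₂ : ℝ, ∃ s < (1 : ℝ), ∀ f : X → ℝ, (∀ x, 0 ≤ f x) → Integrable (fun x => f x ^ τ) μ →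
      Integrable (fun x => f x ^ q) μ → ∫ x, f x ^ τ ∂μ ≤ K → ∀ y ≥ 0,
      ∫ x, f x ^ q ∂μ ≤ D * y ^ (q / p) → ∫ x, f x ^ r ∂μ ≤ C₁ + C₂ * y ^ s := by
  rcases le_or_gt r τ with hrτ | hτr
  · refine ⟨μ.real univ + K, 0, 0, one_pos, fun f hf0 hfτ _ hfK y _ _ => ?_⟩
    have := integral_rpow_le_measureReal_univ_add (hp.trans hpr).le hrτ hf0 hfτ
    linarith
  have hq : 0 < q - τ := by linarith
  set θ := (r - τ) / (q - τ) with hθ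
  have : 0 ≤ θ := div_nonneg (by linarith) hq.le
  refine ⟨0, K ^ ((q - r) / (q - τ)) * D ^ θ, q / p * θ, ?_, fun f hf0 hfτ hfq hfK y hy hfy => ?_⟩
  · rw [hθ, div_mul_div_comm, div_lt_one (by positivity)]
    linarith
  have hτ0 : 0 ≤ ∫ x, f x ^ τ ∂μ := integral_nonneg fun x => Real.rpow_nonneg (hf0 x) _
  have hq0 : 0 ≤ ∫ x, f x ^ q ∂μ := integral_nonneg fun x => Real.rpow_nonneg (hf0 x) _
  have : 0 ≤ (q - r) / (q - τ) := div_nonneg (by linarith) hq.le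
  calc ∫ x, f x ^ r ∂μ ≤ (∫ x, f x ^ τ ∂μ) ^ ((q - r) / (q - τ)) * (∫ x, f x ^ q ∂μ) ^ θ :=
        integral_rpow_le_interpolation hτr hrq (hp.trans hpr).ne' hf0 hfτ hfq
    _ ≤ K ^ ((q - r) / (q - τ)) * (D * y ^ (q / p)) ^ θ := by gcongr
    _ = 0 + K ^ ((q - r) / (q - τ)) * D ^ θ * y ^ (q / p * θ) := by
        rw [Real.mul_rpow hD (Real.rpow_nonneg hy _), ← Real.rpow_mul hy]
        ring

variable {N : ℕ} {p' r' : ℝ} {a₀ m : ℝ → ℝ} {F g : X → ℝ → ℝ}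
  [Fact (1 ≤ ENNReal.ofReal p)] [Fact (1 ≤ ENNReal.ofReal p')] [Fact (1 ≤ ENNReal.ofReal q)]
  [Fact (1 ≤ ENNReal.ofReal r)] [Fact (1 ≤ ENNReal.ofReal r')]

theorem exists_integral_rpow_le_of_abs_sub_le (ha : IsPLaplaceLike p a₀)
    (hp : p.HolderConjugate p') (hr : r.HolderConjugate r') (hg : IsNemytskii μ r r' g)
    (hF : IsPotential μ F g) (hm : IsQuasiSuperlinear μ p r τ F g m) (M : ℝ) :
    ∃ K ≥ 0, ∀ (z : Lp (RN N) (ENNReal.ofReal p) μ) (w : Lp ℝ (ENNReal.ofReal r) μ),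
      |(∫ x, GFun N a₀ (z x) ∂μ) - ∫ x, F x (w x) ∂μ| ≤ M →
      |(ha.isNemytskii hp).pairing hp z z - hg.pairing hr w w| ≤ M →
      Integrable (fun x => m (w x) ^ τ) μ ∧ ∫ x, m (w x) ^ τ ∂μ ≤ K := by
  obtain ⟨C, hC⟩ := ha.exists_pairing_le_mul_integral (N := N) (μ := μ) hp
  obtain ⟨β, hβ, C', hC'⟩ := hm.exists_integral_rpow_le hF hg hr
  refine ⟨max 0 (((p + 1) * M + C + C') / β), le_max_left _ _, fun z w hφ hφ' => ?_⟩
  refine ⟨(hC' w).1, le_max_of_le_right ((le_div_iff₀' hβ).2 ?_)⟩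
  have hpφ := mul_le_mul_of_nonneg_left (abs_le.1 hφ).2 hp.nonneg
  linarith [(hC' w).2, hC z, (abs_le.1 hφ').1]

theorem exists_norm_le_of_abs_sub_le (ha : IsPLaplaceLike p a₀) (hp : p.HolderConjugate p')
    (hr : r.HolderConjugate r') (hpr : p < r) (hrq : r < q) (hqτ : q * (r - p) < τ * (q - p))
    (hg : IsNemytskii μ r r' g) (hF : IsPotential μ F g)
    (hm : IsQuasiSuperlinear μ p r τ F g m) {D : ℝ} (hD : 0 ≤ D) (M : ℝ) :
    ∃ R, ∀ (z : Lp (RN N) (ENNReal.ofReal p) μ) (w : Lp ℝ (ENNReal.ofReal r) μ)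
      (v : Lp ℝ (ENNReal.ofReal q) μ), v =ᵐ[μ] w → ‖v‖ ≤ D * ‖z‖ →
      |(∫ x, GFun N a₀ (z x) ∂μ) - ∫ x, F x (w x) ∂μ| ≤ M →
      |(ha.isNemytskii hp).pairing hp z z - hg.pairing hr w w| ≤ M → ‖z‖ ≤ R := by
  have hq : 0 < q := (hp.pos.trans hpr).trans hrq
  obtain ⟨K, hK, hτ⟩ := exists_integral_rpow_le_of_abs_sub_le (N := N) ha hp hr hg hF hm M
  obtain ⟨c, hc, hcoercive⟩ := ha.exists_norm_rpow_le_pairing (N := N) (μ := μ) hp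
  obtain ⟨A, hA, hpairing⟩ := hm.exists_pairing_le hg hr
  obtain ⟨C₁, C₂, s, hs, hint⟩ := exists_integral_rpow_le_add_mul_rpow (μ := μ) hp.pos hpr hrq hqτ
    hK (Real.rpow_nonneg hD q)
  obtain ⟨B, hB⟩ := exists_le_of_mul_le_add_mul_rpow hc hs (M + A * (μ.real univ + C₁)) (A * C₂)
  refine ⟨|B| ^ p⁻¹, fun z w v hvw hvz hφ hφ' => ?_⟩
  have hmv : (fun x => m (v x) ^ q) =ᵐ[μ] fun x => m (w x) ^ q := hvw.mono fun x hx => by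
    simp only [hx]
  have hmq : ∫ x, m (w x) ^ q ∂μ ≤ D ^ q * (‖z‖ ^ p) ^ (q / p) := by
    rw [← integral_congr_ae hmv, ← Real.rpow_mul (norm_nonneg z), mul_div_cancel₀ _ hp.ne_zero,
      ← Real.mul_rpow hD (norm_nonneg z)]
    exact (hm.integral_rpow_le_norm_rpow hq v).trans
      (Real.rpow_le_rpow (norm_nonneg v) hvz hq.le)
  have hmr : ∫ x, m (w x) ^ r ∂μ ≤ C₁ + C₂ * (‖z‖ ^ p) ^ s :=
    hint _ (fun x => hm.nonneg (w x)) (hτ z w hφ hφ').1 ((hm.integrable_rpow hq v).congr hmv)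
      (hτ z w hφ hφ').2 _ (by positivity) hmq
  have hz : ‖z‖ ^ p ≤ B := by
    refine hB _ ?_
    have hAmr := mul_le_mul_of_nonneg_left hmr hA
    linarith [hcoercive z, hpairing w, (abs_le.1 hφ').2]
  exact (Real.le_rpow_inv_iff_of_pos (norm_nonneg z) (abs_nonneg B) hp.pos).2
    (hz.trans (le_abs_self B))

end APrioriBound

section CeramiCompactness

variable {W Z Y : Type*} [NormedAddCommGroup W] [NormedSpace ℝ W] [NormedAddCommGroup Z]
  [NormedSpace ℝ Z] [NormedAddCommGroup Y] [NormedSpace ℝ Y] {p : ℝ} {A : Z → Z →L[ℝ] ℝ}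
  {B : Y → Y →L[ℝ] ℝ} {T : W →L[ℝ] Z} {J : W →L[ℝ] Y}

theorem IsAlmostUniformlyMonotone.cauchySeq (hA : IsAlmostUniformlyMonotone p A) (hp : 0 < p)
    {z : ℕ → Z} {R : ℝ} (hR : ∀ n, ‖z n‖ ≤ R)
    (hz : Tendsto (fun n : ℕ × ℕ => (A (z n.1) - A (z n.2)) (z n.1 - z n.2)) atTop (𝓝 0)) :
    CauchySeq z := by
  have hR0 : 0 ≤ R := (norm_nonneg _).trans (hR 0)
  refine cauchySeq_of_tendsto_norm_sub_rpow hp (tendsto_order.2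
    ⟨fun ε hε => .of_forall fun n => hε.trans_le (by positivity), fun ε hε => ?_⟩)
  have hden : 0 < 4 * (R ^ p + 1) := by positivity
  obtain ⟨C, hC⟩ := hA (ε / (4 * (R ^ p + 1))) (div_pos hε hden)
  have hCz := hz.const_mul C
  rw [mul_zero] at hCz
  filter_upwards [hCz.eventually_lt_const (half_pos hε)] with n hn
  have hRp : ∀ k, ‖z k‖ ^ p ≤ R ^ p := fun k => Real.rpow_le_rpow (norm_nonneg _) (hR k) hp.le
  calc ‖z n.1 - z n.2‖ ^ p
      ≤ C * (A (z n.1) - A (z n.2)) (z n.1 - z n.2) +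
          ε / (4 * (R ^ p + 1)) * (‖z n.1‖ ^ p + ‖z n.2‖ ^ p) := hC _ _
    _ < ε / 2 + ε / (4 * (R ^ p + 1)) * (2 * (R ^ p + 1)) := by
        refine add_lt_add_of_lt_of_le hn (mul_le_mul_of_nonneg_left ?_ (div_pos hε hden).le)
        linarith [hRp n.1, hRp n.2]
    _ = ε := by field_simp; ring

/-- Along the sequence `A (T (v n)) ∘ T` is a null sequence plus `B (J (v n)) ∘ J`, hence converges
in the dual space, and the monotonicity of `A` transfers this to `T (v n)`. -/
theorem IsAlmostUniformlyMonotone.cauchySeq_of_tendsto_sub (hA : IsAlmostUniformlyMonotone p A)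
    (hp : 0 < p) (hB : Continuous B) {P : ℝ} (hT : ∀ u, ‖u‖ ≤ P * ‖T u‖) {v : ℕ → W} {R : ℝ}
    (hR : ∀ n, ‖v n‖ ≤ R)
    (hv : Tendsto (fun n => (A (T (v n))).comp T - (B (J (v n))).comp J) atTop (𝓝 0)) {y : Y}
    (hy : Tendsto (fun n => J (v n)) atTop (𝓝 y)) : CauchySeq v := by
  have hBJ : Continuous fun w => (B w).comp J := hB.clm_comp continuous_const
  have hBy : Tendsto (fun n => (B (J (v n))).comp J) atTop (𝓝 ((B y).comp J)) :=
    (hBJ.tendsto y).comp hy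
  have hAv : CauchySeq fun n => (A (T (v n))).comp T := by
    simpa only [sub_add_cancel] using (hv.add hBy).cauchySeq
  have hTv : CauchySeq fun n => T (v n) := by
    refine hA.cauchySeq hp (R := ‖T‖ * R) (fun n => T.le_opNorm_of_le (hR n)) ?_
    have hlim := (cauchySeq_iff_tendsto_dist_atTop_0.1 hAv).mul_const (R + R)
    rw [zero_mul] at hlim
    refine squeeze_zero_norm (fun n => ?_) hlim
    rw [dist_eq_norm, ← map_sub]
    exact ((A (T (v n.1))).comp T - (A (T (v n.2))).comp T).le_opNorm_of_le
      ((norm_sub_le _ _).trans (add_le_add (hR _) (hR _)))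
  rw [cauchySeq_iff_tendsto_dist_atTop_0] at hTv ⊢
  have hlim := hTv.const_mul P
  rw [mul_zero] at hlim
  refine squeeze_zero (fun _ => dist_nonneg) (fun n => ?_) hlim
  rw [dist_eq_norm, dist_eq_norm, ← map_sub]
  exact hT _

theorem CeramiCondition.of_hasFDerivAt [CompleteSpace W] {φ : W → ℝ} (hA : Continuous A)
    (hB : Continuous B) (hφ : ∀ u, HasFDerivAt φ ((A (T u)).comp T - (B (J u)).comp J) u)
    (hp : 0 < p) (hmono : IsAlmostUniformlyMonotone p A) {P : ℝ} (hP : 0 ≤ P)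
    (hT : ∀ u, ‖u‖ ≤ P * ‖T u‖)
    (hbdd : ∀ M, ∃ R, ∀ u, |φ u| ≤ M → |A (T u) (T u) - B (J u) (J u)| ≤ M → ‖T u‖ ≤ R)
    (hcomp : ∀ (u : ℕ → W) (R : ℝ), (∀ n, ‖u n‖ ≤ R) →
      ∃ y, ∃ k : ℕ → ℕ, StrictMono k ∧ Tendsto (fun n => J (u (k n))) atTop (𝓝 y)) :
    CeramiCondition φ := by
  refine ⟨contDiff_one_iff_hasFDerivAt.2 ⟨_, ?_, hφ⟩, fun u ⟨M, hM⟩ hlim => ?_⟩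
  · exact ((hA.comp T.continuous).clm_comp continuous_const).sub
      ((hB.comp J.continuous).clm_comp continuous_const)
  simp only [(hφ _).fderiv] at hlim
  obtain ⟨M', hM'⟩ := hlim.norm.bddAbove_range
  have hnorm : ∀ n (f : W →L[ℝ] ℝ), ‖(1 + ‖u n‖) • f‖ = (1 + ‖u n‖) * ‖f‖ := fun n f => by
    rw [norm_smul, Real.norm_of_nonneg (by positivity)]
  obtain ⟨R, hR⟩ := hbdd (max M M')
  have hTu : ∀ n, ‖T (u n)‖ ≤ R := fun n => by
    have hle := hM' (mem_range_self n)
    rw [hnorm, add_mul, one_mul, mul_comm] at hle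
    exact hR _ (le_max_of_le_left (hM n)) (le_max_of_le_right
      ((ContinuousLinearMap.le_opNorm _ (u n)).trans
        ((le_add_of_nonneg_left (norm_nonneg _)).trans hle)))
  have hu : ∀ n, ‖u n‖ ≤ P * R := fun n =>
    (hT _).trans (mul_le_mul_of_nonneg_left (hTu n) hP)
  have hφ' : Tendsto (fun n => (A (T (u n))).comp T - (B (J (u n))).comp J) atTop (𝓝 0) := by
    refine squeeze_zero_norm (fun n => ?_) (tendsto_zero_iff_norm_tendsto_zero.1 hlim)
    rw [hnorm]
    exact le_mul_of_one_le_left (norm_nonneg _) (le_add_of_nonneg_right (norm_nonneg _))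
  obtain ⟨y, k, hk, hy⟩ := hcomp u _ hu
  obtain ⟨u₀, hu₀⟩ := cauchySeq_tendsto_of_complete (hmono.cauchySeq_of_tendsto_sub hp hB hT
    (fun n => hu (k n)) (hφ'.comp hk.tendsto_atTop) hy)
  exact ⟨u₀, k, hk, hu₀⟩

end CeramiCompactness

section Energy

variable {N : ℕ} {p r : ℝ} {a₀ : ℝ → ℝ} {g : RN N → ℝ → ℝ}

theorem isPotential_primitiveF {μ : Measure (RN N)} (hg : ∀ᵐ x ∂μ, Continuous (g x)) :
    IsPotential μ (primitiveF g) g :=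
  ⟨ae_of_all _ fun _ => intervalIntegral.integral_same, hg.mono fun _ hx s =>
    (intervalIntegral.integral_hasDerivAt_right (hx.intervalIntegrable 0 s)
      (hx.stronglyMeasurableAtFilter _ _) hx.continuousAt).hasGradientAt'⟩

variable {Ω : Set (RN N)} [Fact (1 < p)] [Fact (1 ≤ ENNReal.ofReal r)]
  {J : W1p0 Ω p →L[ℝ] Lp ℝ (ENNReal.ofReal r) (volume.restrict Ω)}

theorem energy_eq (hJ : ∀ u, J u =ᵐ[volume.restrict Ω] u.fn) (u : W1p0 Ω p) :
    energy Ω p a₀ g u = (∫ x in Ω, GFun N a₀ (W1p0.gradL Ω p u x)) -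
      ∫ x in Ω, primitiveF g x (J u x) := by
  rw [energy, ← W1p0.coe_gradL]
  exact congrArg _ (integral_congr_ae ((hJ u).mono fun x hx => by simp only [hx]))

theorem hasFDerivAt_energy [IsFiniteMeasure (volume.restrict Ω)] {p' r' : ℝ}
    [Fact (1 ≤ ENNReal.ofReal p')] [Fact (1 ≤ ENNReal.ofReal r')] (ha : IsPLaplaceLike p a₀)
    (hp : p.HolderConjugate p') (hr : r.HolderConjugate r')
    (hg : IsNemytskii (volume.restrict Ω) r r' g) (hJ : ∀ u, J u =ᵐ[volume.restrict Ω] u.fn)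
    (u : W1p0 Ω p) :
    HasFDerivAt (energy Ω p a₀ g)
      (((ha.isNemytskii hp).pairing hp (W1p0.gradL Ω p u)).comp (W1p0.gradL Ω p) -
        (hg.pairing hr (J u)).comp J) u := by
  rw [funext (energy_eq (a₀ := a₀) (g := g) hJ)]
  exact ((ha.isPotential.hasFDerivAt_integral (ha.isNemytskii hp) hp _).comp u
    (W1p0.gradL Ω p).hasFDerivAt).sub
    (((isPotential_primitiveF hg.continuous).hasFDerivAt_integral hg hr _).comp u J.hasFDerivAt)

end Energy

section Cerami

variable {N : ℕ} {Ω : Set (RN N)} {p r τ : ℝ} [Fact (1 < p)] {a₀ m : ℝ → ℝ} {g : RN N → ℝ → ℝ}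

theorem ceramiCondition_energy (hN : 1 ≤ N) (hb : Bornology.IsBounded Ω) (hΩ : MeasurableSet Ω)
    (ha : IsPLaplaceLike p a₀) (hpr : p < r) (hrc : (r : EReal) < critExp N p)
    (hτ : (r - p) * max (N / p) 1 < τ)
    (hg : IsNemytskii (volume.restrict Ω) r r.conjExponent g)
    (hm : IsQuasiSuperlinear (volume.restrict Ω) p r τ (primitiveF g) g m) :
    CeramiCondition (energy Ω p a₀ g) := by
  have hp : 1 < p := Fact.out
  have hr : 1 < r := hp.trans hpr
  have : IsFiniteMeasure (volume.restrict Ω) := ⟨by simpa using hb.measure_lt_top⟩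
  obtain ⟨q, hrq, hqc, hqτ⟩ := exists_interpolation_exponent (zero_lt_one.trans hp) hpr hrc hτ
  have hp' := Real.HolderConjugate.conjExponent hp
  have hr' := Real.HolderConjugate.conjExponent hr
  have : Fact (1 ≤ ENNReal.ofReal p.conjExponent) := ⟨ENNReal.one_le_ofReal.2 hp'.symm.lt.le⟩
  have : Fact (1 ≤ ENNReal.ofReal r) := ⟨ENNReal.one_le_ofReal.2 hr.le⟩
  have : Fact (1 ≤ ENNReal.ofReal r.conjExponent) := ⟨ENNReal.one_le_ofReal.2 hr'.symm.lt.le⟩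
  have : Fact (1 ≤ ENNReal.ofReal q) := ⟨ENNReal.one_le_ofReal.2 (hr.trans hrq).le⟩
  obtain ⟨J, -, hJ, -⟩ := W1p0.exists_sobolev_embedding (Ω := Ω) (p := p) hN hb hrc.le
  obtain ⟨Jq, D, hJq, hD⟩ := W1p0.exists_sobolev_embedding (Ω := Ω) (p := p) hN hb hqc
  obtain ⟨P, hP⟩ := W1p0.exists_norm_le_norm_gradL (Ω := Ω) (p := p) hN hb
  refine .of_hasFDerivAt ((ha.isNemytskii hp').continuous_pairing hp') (hg.continuous_pairing hr')
    (hasFDerivAt_energy ha hp' hr' hg hJ) hp'.pos (ha.isAlmostUniformlyMonotone_pairing hp') P.2 hP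
    (fun M => ?_) fun u R hR => W1p0.exists_subseq_tendsto hN hb hΩ hr hrc hJ hR
  obtain ⟨R, hR⟩ := exists_norm_le_of_abs_sub_le (N := N) ha hp' hr' hpr hrq hqτ hg
    (isPotential_primitiveF hg.continuous) hm D.2 M
  refine ⟨R, fun u hφ => hR _ (J u) (Jq u) ((hJq u).trans (hJ u).symm) (hD u) ?_⟩
  rwa [← energy_eq hJ]

end Cerami

section Reaction

variable {p r s S : ℝ}

theorem abs_le_mul_one_add_rpow {φ : ℝ → ℝ} {A b : ℝ} (hb : 0 ≤ b)
    (hφ : ∀ s, |φ s| ≤ A * (1 + |s| ^ b)) (hs : |s| ≤ S) : |φ s| ≤ A * (1 + S ^ b) := by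
  have : 0 ≤ A := nonneg_of_mul_nonneg_left ((abs_nonneg _).trans (hφ s)) (by positivity)
  exact (hφ s).trans (by gcongr)

theorem abs_intervalIntegral_le_mul_one_add_rpow {φ : ℝ → ℝ} {A b : ℝ} (hb : 0 ≤ b)
    (hφ : ∀ s, |φ s| ≤ A * (1 + |s| ^ b)) (hs : |s| ≤ S) :
    |∫ t in (0 : ℝ)..s, φ t| ≤ A * (1 + S ^ b) * S := by
  have hle : ∀ t ∈ uIoc 0 s, ‖φ t‖ ≤ A * (1 + S ^ b) := fun t ht => by
    have hts := abs_sub_left_of_mem_uIcc (uIoc_subset_uIcc ht)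
    rw [sub_zero, sub_zero] at hts
    exact abs_le_mul_one_add_rpow hb hφ (hts.trans hs)
  refine (intervalIntegral.norm_integral_le_of_norm_le_const hle).trans ?_
  rw [sub_zero]
  exact mul_le_mul_of_nonneg_left hs
    ((abs_nonneg _).trans (abs_le_mul_one_add_rpow hb hφ hs))

theorem one_add_rpow_sub_one_mul_le {y : ℝ} (hr : 1 ≤ r) (hy : 0 ≤ y) :
    (1 + y ^ (r - 1)) * y ≤ 2 * (1 + y ^ r) := by
  have hyr : y ^ (r - 1) * y = y ^ r := by
    rw [← Real.rpow_add_one' hy (by linarith), sub_add_cancel]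
  have hnonneg := Real.rpow_nonneg hy r
  have hle : y ≤ 1 + y ^ r := by
    rcases le_total y 1 with hy1 | hy1
    · linarith
    · linarith [Real.self_le_rpow_of_one_le hy1 hr]
  linarith

variable {N : ℕ} {Ω : Set (RN N)} {f : RN N → ℝ → ℝ}

/-- The reactions of growth `r` for which `f(x, s) s - p F(x, s)` grows at least like a power of
`|s|` large enough for the Cerami condition. The limit inferior at infinity is encoded by a lower
bound for all `s`. -/
structure IsReaction (Ω : Set (RN N)) (p r : ℝ) (f : RN N → ℝ → ℝ) : Prop where
  caratheodory : IsCaratheodory Ω f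
  zero : ∀ᵐ x ∂volume.restrict Ω, f x 0 = 0
  growth : ∃ A ≥ 0, ∀ᵐ x ∂volume.restrict Ω, ∀ s, |f x s| ≤ A * (1 + |s| ^ (r - 1))
  quasi_superlinear : ∃ τ, (r - p) * max (N / p) 1 < τ ∧ ∃ β > 0, ∃ C,
    ∀ᵐ x ∂volume.restrict Ω, ∀ s, β * |s| ^ τ - C ≤ f x s * s - p * primitiveF f x s

theorem HypF.exists_abs_le [Fact (1 < p)] {c₁ : ℝ} (hf : HypF Ω p c₁ r f) :
    ∃ A ≥ 0, ∀ᵐ x ∂volume.restrict Ω, ∀ s, |f x s| ≤ A * (1 + |s| ^ (r - 1)) := by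
  obtain ⟨α, ⟨hα, -⟩, hle⟩ := hf.growth
  refine ⟨lpNorm α ⊤ (volume.restrict Ω), lpNorm_nonneg, ?_⟩
  filter_upwards [hle, ae_le_lpNorm_exponent_top hα] with x hx hαx s
  exact (hx s).trans
    (mul_le_mul_of_nonneg_right ((le_abs_self _).trans hαx) (by positivity))

theorem le_mul_self_sub_mul_primitiveF {x : RN N} {A b τ β : ℝ} (hp : 0 ≤ p) (hb : 0 ≤ b)
    (hτ : 0 ≤ τ) (hβ : 0 ≤ β) (hS : 0 < S) (hf : ∀ s, |f x s| ≤ A * (1 + |s| ^ b))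
    (hfar : ∀ s, S ≤ |s| → β ≤ (f x s * s - p * primitiveF f x s) / |s| ^ τ) (s : ℝ) :
    β * |s| ^ τ - ((1 + p) * (A * (1 + S ^ b) * S) + β * S ^ τ) ≤
      f x s * s - p * primitiveF f x s := by
  have hA : 0 ≤ A := nonneg_of_mul_nonneg_left ((abs_nonneg _).trans (hf s)) (by positivity)
  rcases le_total S |s| with hs | hs
  · have hle := hfar s hs
    rw [le_div_iff₀ (Real.rpow_pos_of_pos (hS.trans_le hs) _)] at hle
    exact (sub_le_self _ (by positivity)).trans hle
  · have hfs : |f x s * s| ≤ A * (1 + S ^ b) * S := by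
      rw [abs_mul]
      exact mul_le_mul (abs_le_mul_one_add_rpow hb hf hs) hs (abs_nonneg _) (by positivity)
    have hF := mul_le_mul_of_nonneg_left
      (abs_le.1 (abs_intervalIntegral_le_mul_one_add_rpow hb hf hs)).2 hp
    have hβs : β * |s| ^ τ ≤ β * S ^ τ := by gcongr
    rw [primitiveF]
    linarith [(abs_le.1 hfs).1]

theorem HypF.isReaction [Fact (1 < p)] {c₁ : ℝ} (hf : HypF Ω p c₁ r f) : IsReaction Ω p r f := by
  have hp : 1 < p := Fact.out
  have hpr := hf.p_lt_r
  obtain ⟨A, hA, hle⟩ := hf.exists_abs_le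
  obtain ⟨τ, hτ, -, β, hβ, hliminf⟩ := hf.quasi_superlinear
  obtain ⟨S, hS, hfar⟩ := hliminf (β / 2) (half_pos hβ)
  have hτ0 : 0 ≤ τ := le_trans
    (mul_nonneg (sub_pos.2 hpr).le (zero_le_one.trans (le_max_right _ _))) hτ.le
  refine ⟨hf.caratheodory, hf.zero, ⟨A, hA, hle⟩, τ, hτ, β / 2, half_pos hβ,
    (1 + p) * (A * (1 + S ^ (r - 1)) * S) + β / 2 * S ^ τ, ?_⟩
  filter_upwards [hle, hfar] with x hx hfarx
  rw [sub_half] at hfarx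
  exact le_mul_self_sub_mul_primitiveF (by linarith) (by linarith) hτ0 (half_pos hβ).le hS hx hfarx

end Reaction

section Truncation

variable {ρ : ℝ → ℝ}

/-- The truncations `s ↦ s`, `s ↦ s⁺` and `s ↦ -s⁻` of the argument of a reaction, characterized by
being the identity or zero on each segment from `0`. -/
structure IsTruncation (ρ : ℝ → ℝ) : Prop where
  continuous : Continuous ρ
  eq_or : ∀ s, (∀ t ∈ uIcc 0 s, ρ t = t) ∨ ∀ t ∈ uIcc 0 s, ρ t = 0

theorem isTruncation_id : IsTruncation id := ⟨continuous_id, fun _ => .inl fun _ _ => rfl⟩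

theorem isTruncation_max_zero : IsTruncation fun s => max s 0 := by
  refine ⟨by fun_prop, fun s => ?_⟩
  rcases le_total 0 s with hs | hs
  · exact .inl fun t ht => max_eq_left (uIcc_of_le hs ▸ ht).1
  · exact .inr fun t ht => max_eq_right (uIcc_of_ge hs ▸ ht).2

theorem isTruncation_neg_max_neg_zero : IsTruncation fun s => -max (-s) 0 := by
  refine ⟨by fun_prop, fun s => ?_⟩
  rcases le_total 0 s with hs | hs
  · exact .inr fun t ht => by rw [max_eq_right (neg_nonpos.2 (uIcc_of_le hs ▸ ht).1), neg_zero]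
  · exact .inl fun t ht => by rw [max_eq_left (neg_nonneg.2 (uIcc_of_ge hs ▸ ht).2), neg_neg]

namespace IsTruncation

theorem eq_self_or_eq_zero (hρ : IsTruncation ρ) (s : ℝ) : ρ s = s ∨ ρ s = 0 :=
  (hρ.eq_or s).imp (· s right_mem_uIcc) (· s right_mem_uIcc)

theorem abs_le (hρ : IsTruncation ρ) (s : ℝ) : |ρ s| ≤ |s| := by
  rcases hρ.eq_self_or_eq_zero s with hs | hs <;> simp [hs]

theorem comp_mul (hρ : IsTruncation ρ) {φ : ℝ → ℝ} (hφ : φ 0 = 0) (s : ℝ) :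
    φ (ρ s) * s = φ (ρ s) * ρ s := by
  rcases hρ.eq_self_or_eq_zero s with hs | hs <;> simp [hs, hφ]

variable {N : ℕ} {f : RN N → ℝ → ℝ}

theorem primitiveF_comp (hρ : IsTruncation ρ) {x : RN N} (hx : f x 0 = 0) (s : ℝ) :
    primitiveF (fun x s => f x (ρ s)) x s = primitiveF f x (ρ s) := by
  rcases hρ.eq_or s with hs | hs
  · rw [hs s right_mem_uIcc]
    exact intervalIntegral.integral_congr fun t ht => by simp only [hs t ht]
  · rw [hs s right_mem_uIcc, primitiveF, primitiveF, intervalIntegral.integral_same]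
    exact intervalIntegral.integral_zero_ae (ae_of_all _ fun t ht => by
      rw [hs t (uIoc_subset_uIcc ht), hx])

end IsTruncation

namespace IsReaction

variable {N : ℕ} {Ω : Set (RN N)} {p r r' : ℝ} {f : RN N → ℝ → ℝ}

theorem isNemytskii_comp (hf : IsReaction Ω p r f) (hr : r.HolderConjugate r')
    (hρ : IsTruncation ρ) : IsNemytskii (volume.restrict Ω) r r' fun x s => f x (ρ s) := by
  obtain ⟨A, -, hA⟩ := hf.growth
  refine .of_norm_le (A := A) hr (fun s => (hf.caratheodory.measurable (ρ s)).aestronglyMeasurable)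
    (hf.caratheodory.continuous.mono fun x hx => hx.comp hρ.continuous)
    (hA.mono fun x hx s => ?_)
  rw [Real.norm_eq_abs, Real.norm_eq_abs]
  exact abs_le_mul_one_add_rpow hr.sub_one_pos.le hx (hρ.abs_le s)

theorem exists_isQuasiSuperlinear_comp (hf : IsReaction Ω p r f) (hr : 1 ≤ r)
    (hρ : IsTruncation ρ) : ∃ τ, (r - p) * max (N / p) 1 < τ ∧
      IsQuasiSuperlinear (volume.restrict Ω) p r τ (primitiveF fun x s => f x (ρ s))
        (fun x s => f x (ρ s)) fun s => |ρ s| := by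
  obtain ⟨A, hA, hgrowth⟩ := hf.growth
  obtain ⟨τ, hτ, β, hβ, C, hlower⟩ := hf.quasi_superlinear
  refine ⟨τ, hτ, hρ.continuous.abs.measurable, fun _ => abs_nonneg _, hρ.abs_le,
    ⟨A * 2, by positivity, ?_⟩, β, hβ, C, ?_⟩
  · filter_upwards [hgrowth, hf.zero] with x hx hx0 s
    calc f x (ρ s) * s = f x (ρ s) * ρ s := hρ.comp_mul hx0 s
      _ ≤ |f x (ρ s)| * |ρ s| := (le_abs_self _).trans (abs_mul _ _).le
      _ ≤ A * (1 + |ρ s| ^ (r - 1)) * |ρ s| := by gcongr; exact hx _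
      _ ≤ A * 2 * (1 + |ρ s| ^ r) := by
        rw [mul_assoc, mul_assoc]
        exact mul_le_mul_of_nonneg_left (one_add_rpow_sub_one_mul_le hr (abs_nonneg _)) hA
  · filter_upwards [hlower, hf.zero] with x hx hx0 s
    rw [hρ.comp_mul hx0, hρ.primitiveF_comp hx0]
    exact hx (ρ s)

end IsReaction

end Truncation

end

theorem mainTheorem5_general {N : ℕ} (hN : 1 ≤ N) {Ω : Set (RN N)} (hb : Bornology.IsBounded Ω)
    (hΩ : MeasurableSet Ω) {p : ℝ} [Fact (1 < p)] {a₀ : ℝ → ℝ} (ha : IsPLaplaceLike p a₀) {r : ℝ}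
    (hpr : p < r) (hrc : (r : EReal) < critExp N p) {f : RN N → ℝ → ℝ} (hf : IsReaction Ω p r f)
    {ρ : ℝ → ℝ} (hρ : IsTruncation ρ) : CeramiCondition (energy Ω p a₀ fun x s => f x (ρ s)) := by
  have hr : 1 < r := (Fact.out : 1 < p).trans hpr
  obtain ⟨τ, hτ, hm⟩ := hf.exists_isQuasiSuperlinear_comp hr.le hρ
  exact ceramiCondition_energy hN hb hΩ ha hpr hrc hτ
    (hf.isNemytskii_comp (.conjExponent hr) hρ) hm

theorem mainTheorem5 {N : ℕ} (hN : 1 ≤ N) (Ω : Set (RN N)) (hΩ : IsBoundedC2Domain Ω)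
    (p : ℝ) [Fact (1 < p)]
    (ϑ : ℝ → ℝ) (chat c₀ c₁ c₂ : ℝ) (hϑ : IsComparison p ϑ chat c₀ c₁ c₂)
    (a₀ : ℝ → ℝ) (ha : HypA N p ϑ a₀)
    (r : ℝ) (f : RN N → ℝ → ℝ) (hf : HypF Ω p c₁ r f) :
    CeramiCondition (energy Ω p a₀ f) ∧
      CeramiCondition (energy Ω p a₀ (truncPos f)) ∧
      CeramiCondition (energy Ω p a₀ (truncNeg f)) :=
  have cerami {ρ : ℝ → ℝ} (hρ : IsTruncation ρ) :=
    mainTheorem5_general hN hΩ.isBounded hΩ.isOpen.measurableSet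
      (ha.isPLaplaceLike hN Fact.out hϑ) hf.p_lt_r hf.r_lt_crit hf.isReaction hρ
  ⟨cerami isTruncation_id, cerami isTruncation_max_zero, cerami isTruncation_neg_max_neg_zero⟩
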